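/- Let $G=(V,E)$ be a finite simple graph; $N(v)$ is the set of neighbours and $\delta(v)$ the degree of a node $v$. Every node $v$ stores a colour $v.c\in\mathbb N\cup\{\bot\}$ and a Boolean $v.final$. The algorithm $\mathcal A_{col}$ works in synchronous rounds. In each round every node $v$ receives the current values $(w.c,w.final)$ from all $w\in N(v)$ and forms $occupied=\{w.c : w\in N(v),\ w.c\neq\bot\}$ and $tabu=\{w.c : w\in N(v),\ w.c\ne\bot,\ w.final=true\}$. Then: - if $v.c=\bot$ or $v.c>\delta(v)$, it sets $v.final:=false$; - otherwise, if $v.final=true$ and $v.c\in tabu$, it sets $v.final:=false$; if $v.final=false$ and $v.c\notin occupied$, it sets $v.final:=true$; - if now $v.final=false$, it sets $v.c:=\bot$ with probability $1/2$, and otherwise chooses $v.c$ uniformly at random from $\{0,1,\dots,\delta(v)\}\setminus tabu$. The random choices are independent over nodes and rounds. A configuration is *legitimate* if $v.final=true$ and $v.c\in\{0,\dots,\delta(v)\}$ for all $v\in V$, and $v.c\ne w.c$ for all adjacent $v,w$. A *memory corruption at $v$* changes, in a legitimate configuration, the value of at least one of $v.c$, $v.final$ to an arbitrary other value and changes nothing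 else. The *containment time* $T$ of such a fault is the number of rounds until a legitimate configuration is reached by the (afterwards error-free) execution that starts in the corrupted configuration. Let $\delta_i(v)$ be the maximum size of an independent set contained in $N(v)$, and $H_k=\sum_{j=1}^k 1/j$ (with $H_0=0$). **Lemma.** For every finite graph, every legitimate configuration, every node $v$ and every memory corruption at $v$, the containment time $T$ is almost surely finite, has a finite second moment, and satisfies $$\mathbb E[T]\le \frac{1}{\ln 2}H_{\delta_i(v)}+\frac{11}{2},\qquad \operatorname{Var}[T]<7.5 .$$ -/

import Mathlib

open MeasureTheory ProbabilityTheory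

/-! Synchronous randomized colouring of a finite graph `G`. -/

/-- Local memory of a node: its colour (`none` stands for `⊥`) and the flag `final`. -/
@[ext]
structure NodeState where
  color : Option ℕ
  isFinal : Bool

namespace NodeState

def equivProd : NodeState ≃ Option ℕ × Bool where
  toFun s := (s.color, s.isFinal)
  invFun p := ⟨p.1, p.2⟩
  left_inv _ := rfl
  right_inv _ := rfl

instance : Countable NodeState := equivProd.injective.countable

instance : MeasurableSpace NodeState := ⊤

instance : DiscreteMeasurableSpace NodeState := ⟨fun _ => trivial⟩

end NodeState

/-- A configuration assigns a local state to every node. -/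
abbrev Config (V : Type*) := V → NodeState

noncomputable section

namespace Coloring

variable {V : Type*} [Fintype V] (G : SimpleGraph V) [DecidableRel G.Adj]

/-- The colours different from `⊥` received by `v` from its neighbours. -/
def occupied (σ : Config V) (v : V) : Finset ℕ :=
  (G.neighborFinset v).biUnion fun w => (σ w).color.toFinset

/-- The colours different from `⊥` received by `v` from neighbours whose flag is `true`. -/
def tabu (σ : Config V) (v : V) : Finset ℕ :=
  {w ∈ G.neighborFinset v | (σ w).isFinal = true}.biUnion fun w => (σ w).color.toFinset

/-- The colours `{0, …, δ(v)} \ tabu` available to `v`. -/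
def palette (σ : Config V) (v : V) : Finset ℕ :=
  Finset.range (G.degree v + 1) \ tabu G σ v

lemma card_tabu_le (σ : Config V) (v : V) : (tabu G σ v).card ≤ G.degree v := by
  refine Finset.card_biUnion_le.trans ?_
  refine (Finset.sum_le_card_nsmul _ _ 1 fun w _ => ?_).trans ?_
  · cases (σ w).color <;> simp
  · rw [smul_eq_mul, mul_one, ← G.card_neighborFinset_eq_degree]
    exact Finset.card_filter_le _ _

lemma palette_nonempty (σ : Config V) (v : V) : (palette G σ v).Nonempty := by
  rw [← Finset.card_pos]
  have h := Finset.le_card_sdiff (tabu G σ v) (Finset.range (G.degree v + 1))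
  rw [Finset.card_range] at h
  have h' := card_tabu_le G σ v
  unfold palette
  omega

/-- The function `randomColor`: with probability `1/2` the result is `⊥`, otherwise it is a
uniformly random colour of the palette. -/
def randomColor (σ : Config V) (v : V) : PMF (Option ℕ) :=
  (PMF.uniformOfFintype Bool).bind fun bit =>
    if bit then PMF.pure none
    else (PMF.uniformOfFinset (palette G σ v) (palette_nonempty G σ v)).map some

/-- The value of the flag `final` of `v` after the deterministic part of a round. -/
def newFinal (σ : Config V) (v : V) : Bool :=
  match (σ v).color with
  | none => false
  | some k =>
    if G.degree v < k then false
    else if (σ v).isFinal then decide (k ∉ tabu G σ v)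
    else decide (k ∉ occupied G σ v)

/-- The law of the state of `v` after one round that starts in the configuration `σ`. -/
def nodeStep (σ : Config V) (v : V) : PMF NodeState :=
  if newFinal G σ v then PMF.pure ⟨(σ v).color, true⟩
  else (randomColor G σ v).map fun c => ⟨c, false⟩

/-- One synchronous round: all nodes make one step, with independent random choices. -/
def step : Kernel (Config V) (Config V) :=
  Kernel.ofFunOfCountable fun σ => Measure.pi fun v => (nodeStep G σ v).toMeasure

instance : IsMarkovKernel (step G) :=
  ⟨fun σ => inferInstanceAs
    (IsProbabilityMeasure (Measure.pi fun v => (nodeStep G σ v).toMeasure))⟩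

/-- The round after time `n`, as a kernel on histories; it only depends on the present. -/
def histStep (n : ℕ) : Kernel ((_ : Finset.Iic n) → Config V) (Config V) :=
  (step G).comap (fun h => h ⟨n, Finset.mem_Iic.2 le_rfl⟩) (measurable_pi_apply _)

instance (n : ℕ) : IsMarkovKernel (histStep G n) := by
  unfold histStep; infer_instance

/-- The law of the error-free execution of the algorithm (a Markov chain) started in `σ`. The
configuration at the end of round `n` is the `n`-th coordinate. -/
def execution (σ : Config V) : Measure (ℕ → Config V) :=
  Kernel.trajMeasure (X := fun _ => Config V) (Measure.dirac σ) (histStep G)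

/-- Legitimate configurations: a proper colouring in which every node `v` has a colour
in `{0, …, δ(v)}` and every flag is `true`. -/
def Legitimate (σ : Config V) : Prop :=
  (∀ v, (σ v).isFinal = true ∧ ∃ k, (σ v).color = some k ∧ k ≤ G.degree v) ∧
    ∀ v w, G.Adj v w → (σ v).color ≠ (σ w).color

/-- `σ` arises from `ρ` by a corruption of the memory of `v`: at least one of the two variables
of `v` gets a wrong value, and nothing else changes. -/
def MemoryCorruption (ρ σ : Config V) (v : V) : Prop :=
  σ v ≠ ρ v ∧ ∀ w, w ≠ v → σ w = ρ w

/-- The number of rounds until a legitimate configuration is reached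
(of interest only for executions that do reach one). -/
def recoveryTime (ω : ℕ → Config V) : ℕ :=
  sInf {n | Legitimate G (ω n)}

/-- The independent degree `δ_i(v)`: the maximum size of an independent set of neighbours. -/
def indepDegree {V : Type*} (G : SimpleGraph V) (v : V) : ℕ :=
  (G.induce (G.neighborSet v)).indepNum

end Coloring

end

/-!
If the corrupted node `v` keeps its colour in the first round, then this is the original one or a
colour that no neighbour has, and `T ≤ 1` for the containment time `T`. Otherwise let `W` be the set
of neighbours that, after the fault, have the same colour as `v`, in case the flag of `v` is set;
`W` is empty if it is not. Since the original colouring is proper, `W` is independent, and `n = #W ≤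
δ_i(v)`. Only `v` and the nodes of `W` ever change: `v` and the leaves in `W` form a star
(`IsStar`), and from the first round on every conflict is one between `v` and a leaf (`IsPrepared`,
`IsConfined`).

*Upper tail.* There is a `potential` of confined configurations whose mean is at least halved by
every round (`IsConfined.lintegral_potential_le`), and which is at least `1` if the next
configuration is not certain to be legitimate. A pending leaf contributes `1`: it draws `⊥`, and so
stays pending, with probability `1/2`. The share of a pending centre (`excess`) depends on the
number `m` of pending leaves and the number `M` of leaves whose flag is not set, and for `m ≥ 1` it
is linear in `m`. Its mean over a round is controlled because `v` draws each of at least `M + 1`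
colours with the same probability, and because it draws independently of the leaves. As the mean of
the potential after the first round is at most half of `initBound n`, which is `17/5 n + 33/5` for
`n ≥ 1`, it follows that `P(T > t + 1) ≤ 2⁻ᵗ initBound n`.

*Lower tail.* All `n + 1` nodes of the star are pending in the first round, and a node that draws
`⊥` is pending again. Hence `P(T ≤ t + 1) ≤ (1 - 2⁻ᵗ) ^ (n + 1)` (`stepExp_iterate_legitimate_le`).

*Moments.* The upper tail gives `E T ≤ log₂ (initBound n) + 3`, and `log (n + 1) ≤ H_n`. For the
variance, the second moment of `T - 1 - k - e` is written as a sum over both tails. With a suitable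
integer `k` (close to `log₂ (n + 1) + 2`) and `e ∈ {0, 1/2}`, its bound `momentBound` is smaller
than `15/2` for every `n`: as `n` grows, it becomes a convex function of `B = (n + 1) / 2 ^ k`, so
that it has to be estimated only at the ends of an interval (`exists_momentBound_lt_of_large`), and
the finitely many small values of `n` are checked by evaluation (`momentBoundRat_lt`).
-/

noncomputable section

namespace Coloring

open scoped ENNReal

/-! ### The law of an execution -/

section

variable {V : Type*} [Fintype V] (G : SimpleGraph V) [DecidableRel G.Adj]

instance (σ : Config V) : IsProbabilityMeasure (execution G σ) := by
  unfold execution; infer_instance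

/-- The one-step operator of the Markov chain: `stepExp G f X` is the expectation of `f` after one
round that starts in `X`. -/
def stepExp (f : Config V → ℝ≥0∞) (X : Config V) : ℝ≥0∞ := ∫⁻ Y, f Y ∂(step G X)

lemma lintegral_execution_zero (σ : Config V) (f : Config V → ℝ≥0∞) :
    ∫⁻ ω, f (ω 0) ∂(execution G σ) = f σ := by
  have hmap : (execution G σ).map (fun ω => ω 0) = Measure.dirac σ := by
    have h0 : (fun ω : ℕ → Config V => ω 0) =
        (fun x : ((_ : Finset.Iic 0) → Config V) => x ⟨0, by simp⟩) ∘
          (Preorder.frestrictLe (π := fun _ => Config V) 0) := rfl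
    rw [execution, Kernel.trajMeasure, Measure.map_dirac' (by fun_prop),
      Measure.dirac_bind (by fun_prop), h0,
      ← Measure.map_map (by fun_prop) (by fun_prop),
      Kernel.traj_map_frestrictLe_apply, Kernel.partialTraj_self, Kernel.id_apply,
      Measure.map_dirac' (by fun_prop)]
    rfl
  rw [← lintegral_map (measurable_of_countable f) (by fun_prop), hmap,
    lintegral_dirac' _ (measurable_of_countable f)]

/-- The Markov property, for two consecutive configurations. -/
lemma lintegral_execution_pair (σ : Config V) (f : Config V → Config V → ℝ≥0∞) (t : ℕ) :
    ∫⁻ ω, f (ω t) (ω (t + 1)) ∂(execution G σ) =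
      ∫⁻ ω, ∫⁻ Y, f (ω t) Y ∂(step G (ω t)) ∂(execution G σ) := by
  have h := Kernel.map_frestrictLe_trajMeasure_compProd_eq_map_trajMeasure
    (X := fun _ => Config V) (μ₀ := Measure.dirac σ) (κ := histStep G) (a := t)
  have hev : Measurable fun p : ((_ : Finset.Iic t) → Config V) × Config V =>
      (p.1 ⟨t, Finset.mem_Iic.2 le_rfl⟩, p.2) := by fun_prop
  have hf : Measurable fun p : ((_ : Finset.Iic t) → Config V) × Config V =>
      f (p.1 ⟨t, Finset.mem_Iic.2 le_rfl⟩) p.2 :=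
    (measurable_of_countable (Function.uncurry f)).comp hev
  have h1 := lintegral_map (μ := execution G σ) hf
    (g := fun x => (Preorder.frestrictLe (π := fun _ => Config V) t x, x (t + 1))) (by fun_prop)
  refine h1.symm.trans ?_
  unfold execution
  rw [← h, Measure.lintegral_compProd hf,
    lintegral_map hf.lintegral_kernel_prod_right (by fun_prop)]
  rfl

lemma lintegral_execution (σ : Config V) (f : Config V → ℝ≥0∞) (t : ℕ) :
    ∫⁻ ω, f (ω t) ∂(execution G σ) = (stepExp G)^[t] f σ := by
  induction t generalizing f with
  | zero => exact lintegral_execution_zero G σ f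
  | succ t ih =>
    rw [Function.iterate_succ_apply, lintegral_execution_pair G σ (fun _ => f), ← ih (stepExp G f)]
    rfl

lemma execution_mem (σ : Config V) (s : Set (Config V)) (t : ℕ) :
    execution G σ {ω | ω t ∈ s} = (stepExp G)^[t] (s.indicator 1) σ := by
  rw [← lintegral_execution, ← lintegral_indicator_one]
  · rfl
  · exact measurableSet_preimage (measurable_pi_apply t) (Set.to_countable s).measurableSet

lemma ae_execution_step (σ : Config V) (r : Config V → Config V → Prop)
    (h : ∀ X, ∀ᵐ Y ∂(step G X), r X Y) :
    ∀ᵐ ω ∂(execution G σ), ∀ t, r (ω t) (ω (t + 1)) := by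
  classical
  rw [ae_all_iff]
  intro t
  have h0 := lintegral_execution_pair G σ
    (fun X Y => {p : Config V × Config V | ¬ r p.1 p.2}.indicator 1 (X, Y)) t
  have h1 : ∀ X, ∫⁻ Y, {p : Config V × Config V | ¬ r p.1 p.2}.indicator 1 (X, Y) ∂(step G X)
      = (0 : ℝ≥0∞) := by
    intro X
    rw [lintegral_eq_zero_iff (measurable_of_countable _)]
    filter_upwards [h X] with Y hY
    simp [hY]
  simp only [h1, lintegral_zero] at h0
  rw [lintegral_eq_zero_iff] at h0
  · filter_upwards [h0] with ω hω
    by_contra hn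
    simp [hn] at hω
  · have hev : Measurable fun ω : ℕ → Config V => (ω t, ω (t + 1)) := by fun_prop
    exact (measurable_of_countable
      ({p : Config V × Config V | ¬ r p.1 p.2}.indicator (1 : Config V × Config V → ℝ≥0∞))).comp hev

end

/-! ### One round -/

section

variable {V : Type*} [Fintype V] (G : SimpleGraph V) [DecidableRel G.Adj]

lemma step_apply (X : Config V) :
    step G X = Measure.pi fun u => (nodeStep G X u).toMeasure := rfl

lemma integrable_step_of_bounded (X : Config V) {f : Config V → ℝ} (C : ℝ) (h : ∀ Y, |f Y| ≤ C) :
    Integrable f (step G X) :=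
  Integrable.of_bound (measurable_of_countable f).aestronglyMeasurable C (.of_forall h)

/-- The nodes make their steps independently. -/
lemma step_real_rect (X : Config V) (s : Finset V) (f : V → Set NodeState) :
    (step G X).real {Y | ∀ u ∈ s, Y u ∈ f u} = ∏ u ∈ s, (nodeStep G X u).toMeasure.real (f u) := by
  have h := Measure.pi_pi_finset (fun u => (nodeStep G X u).toMeasure) f s
  rw [measureReal_def, step_apply]
  have : {Y : Config V | ∀ u ∈ s, Y u ∈ f u} = (s : Set V).pi f := by
    ext Y; simp [Set.mem_pi]
  rw [this, h, ENNReal.toReal_prod]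
  rfl

lemma randomColor_none (X : Config V) (u : V) : randomColor G X u none = 2⁻¹ := by
  simp [randomColor, PMF.bind_apply, tsum_fintype, PMF.pure_apply, PMF.map_apply]

lemma randomColor_some (X : Config V) (u : V) (k : ℕ) :
    randomColor G X u (some k) =
      if k ∈ palette G X u then 2⁻¹ * ((palette G X u).card : ℝ≥0∞)⁻¹ else 0 := by
  classical
  simp [randomColor, PMF.bind_apply, tsum_fintype, PMF.pure_apply, PMF.map_apply]

/-- The probability with which `u` draws the colour `c` (`none` stands for `⊥`) in a round that
starts in `X`. It is meaningful if `u` is pending in `X`, and defined for all `u`. -/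
def colorProb (X : Config V) (u : V) (c : Option ℕ) : ℝ := (randomColor G X u c).toReal

lemma colorProb_nonneg (X : Config V) (u : V) (c : Option ℕ) : 0 ≤ colorProb G X u c :=
  ENNReal.toReal_nonneg

lemma colorProb_none (X : Config V) (u : V) : colorProb G X u none = 1 / 2 := by
  simp [colorProb, randomColor_none]

lemma colorProb_some (X : Config V) (u : V) (k : ℕ) : colorProb G X u (some k) =
    if k ∈ palette G X u then 1 / (2 * ((palette G X u).card : ℝ)) else 0 := by
  rw [colorProb, randomColor_some]
  split_ifs <;> simp [mul_comm]

lemma nodeStep_real_of_pending {X : Config V} {u : V} (h : newFinal G X u = false)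
    (s : Set NodeState) :
    (nodeStep G X u).toMeasure.real s =
      ((randomColor G X u).toOuterMeasure {c | ⟨c, false⟩ ∈ s}).toReal := by
  rw [measureReal_def, PMF.toMeasure_apply_eq_toOuterMeasure_apply _ .of_discrete]
  simp only [nodeStep, h, Bool.false_eq_true, if_false]
  rw [PMF.toOuterMeasure_map_apply]
  rfl

lemma nodeStep_real_color {X : Config V} {u : V} (h : newFinal G X u = false) (c : Option ℕ) :
    (nodeStep G X u).toMeasure.real {s | s.color = c} = colorProb G X u c := by
  rw [nodeStep_real_of_pending G h, colorProb, ← PMF.toOuterMeasure_apply_singleton]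
  congr 2

lemma nodeStep_real_color_ne_none {X : Config V} {u : V} (h : newFinal G X u = false) :
    (nodeStep G X u).toMeasure.real {s | s.color ≠ none} = 1 / 2 := by
  have h1 : {s : NodeState | s.color ≠ none} = {s | s.color = none}ᶜ := rfl
  rw [h1, probReal_compl_eq_one_sub .of_discrete, nodeStep_real_color G h, colorProb_none]
  norm_num

/-- `Y` has the form of an outcome of a round that starts in `X`: a node whose flag is set in the
deterministic part keeps its colour, and every other node draws `⊥` or a colour of its palette. -/
def IsSuccessor (X Y : Config V) : Prop :=
  ∀ u, (newFinal G X u = true → Y u = ⟨(X u).color, true⟩) ∧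
    (newFinal G X u = false → (Y u).isFinal = false ∧
      ∀ k, (Y u).color = some k → k ∈ palette G X u)

lemma ae_isSuccessor (X : Config V) : ∀ᵐ Y ∂(step G X), IsSuccessor G X Y := by
  classical
  refine ae_all_iff.2 fun u => ?_
  have hq := (measurePreserving_eval (fun u => (nodeStep G X u).toMeasure) u).quasiMeasurePreserving
  refine hq.ae (p := fun s : NodeState => (newFinal G X u = true → s = ⟨(X u).color, true⟩) ∧
    (newFinal G X u = false → s.isFinal = false ∧
      ∀ k, s.color = some k → k ∈ palette G X u)) ?_
  rw [ae_iff, PMF.toMeasure_apply_eq_zero_iff _ .of_discrete, Set.disjoint_left]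
  intro s hs hn
  apply hn
  rw [nodeStep] at hs
  cases hf : newFinal G X u
  · simp only [hf, Bool.false_eq_true, if_false, PMF.mem_support_map_iff] at hs
    obtain ⟨c, hc, rfl⟩ := hs
    refine ⟨by simp, fun _ => ⟨rfl, fun k hk => ?_⟩⟩
    simp only at hk
    subst hk
    by_contra hk
    rw [PMF.mem_support_iff, randomColor_some] at hc
    simp [hk] at hc
  · simp only [hf, if_true, PMF.support_pure, Set.mem_singleton_iff] at hs
    simp [hs]

/-- The nodes that draw a new colour in the round that starts in `X`. -/
def pending (X : Config V) : Finset V := {u | newFinal G X u = false}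

lemma newFinal_of_color_none {X : Config V} {u : V} (h : (X u).color = none) :
    newFinal G X u = false := by
  simp [newFinal, h]

/-- A bound from above for the probability of a fast recovery. The nodes that draw `⊥` are all
pending in the next round, and so the number of pending nodes dominates that of a process in which
every pending node is done with probability `1/2` in each round. -/
lemma stepExp_iterate_legitimate_le (t : ℕ) (X : Config V) :
    (stepExp G)^[t + 1] ({Y | Legitimate G Y}.indicator 1) X ≤
      ENNReal.ofReal ((1 - (1 / 2) ^ t) ^ (pending G X).card) := by
  classical
  induction t generalizing X with
  | zero =>
    simp only [zero_add, Function.iterate_one, pow_zero, sub_self]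
    rcases (pending G X).eq_empty_or_nonempty with h | ⟨u, hu⟩
    · rw [h]
      simp only [Finset.card_empty, pow_zero, ENNReal.ofReal_one, stepExp]
      rw [lintegral_indicator_one (Set.to_countable _).measurableSet]
      exact prob_le_one
    · refine le_of_eq_of_le ?_ zero_le
      rw [stepExp, lintegral_eq_zero_iff (measurable_of_countable _)]
      filter_upwards [ae_isSuccessor G X] with Y hY
      have h1 := ((hY u).2 (by simpa [pending] using hu)).1
      have h2 : ¬ Legitimate G Y := fun hL => by simpa [h1] using (hL.1 u).1
      simp [h2]
  | succ t ih =>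
    rw [Function.iterate_succ_apply']
    set b : ℝ := 1 - (1 / 2) ^ t with hb
    have hb0 : 0 ≤ b := sub_nonneg.2 (pow_le_one₀ (by norm_num) (by norm_num))
    have hb1 : b ≤ 1 := by rw [hb]; linarith [pow_nonneg (by norm_num : (0 : ℝ) ≤ 1 / 2) t]
    let f : V → NodeState → ℝ := fun u s => if u ∈ pending G X ∧ s.color = none then b else 1
    have hf0 : ∀ u s, 0 ≤ f u s := fun u s => by simp only [f]; split_ifs <;> linarith
    have hf1 : ∀ u s, f u s ≤ 1 := fun u s => by simp only [f]; split_ifs <;> linarith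
    have key : ∀ Y : Config V, b ^ (pending G Y).card ≤ ∏ u, f u (Y u) := by
      intro Y
      have : ∏ u, f u (Y u) = b ^ (Finset.univ.filter
          fun u => u ∈ pending G X ∧ (Y u).color = none).card := by
        simp only [f]
        rw [Finset.prod_ite, Finset.prod_const, Finset.prod_const_one, mul_one]
      rw [this]
      refine pow_le_pow_of_le_one hb0 hb1 (Finset.card_le_card fun u hu => ?_)
      simp only [Finset.mem_filter, Finset.mem_univ, true_and] at hu
      simp [pending, newFinal_of_color_none G hu.2]
    have hint : ∫ Y, ∏ u, f u (Y u) ∂(step G X) =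
        (1 - (1 / 2) ^ (t + 1)) ^ (pending G X).card := by
      rw [step_apply, integral_fintype_prod_eq_prod]
      have h1 : ∀ u, ∫ s, f u s ∂(nodeStep G X u).toMeasure =
          if u ∈ pending G X then (1 - (1 / 2) ^ (t + 1)) else 1 := by
        intro u
        split_ifs with hu
        · have h2 : f u = fun s => {s : NodeState | s.color = none}.indicator (fun _ => b - 1) s
              + 1 := by
            funext s
            by_cases hs : s.color = none <;> simp [f, hu, hs]
          rw [h2, integral_add ((integrable_const _).indicator .of_discrete) (integrable_const _),
            integral_indicator_const _ .of_discrete,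
            nodeStep_real_color G (by simpa [pending] using hu), colorProb_none]
          simp [hb]
          ring
        · have h2 : f u = fun _ => 1 := by funext s; simp [f, hu]
          simp [h2]
      simp only [h1]
      rw [Finset.prod_ite, Finset.prod_const, Finset.prod_const_one, mul_one]
      simp
    calc stepExp G ((stepExp G)^[t + 1] ({Y | Legitimate G Y}.indicator 1)) X
        ≤ ∫⁻ Y, ENNReal.ofReal (∏ u, f u (Y u)) ∂(step G X) :=
          lintegral_mono fun Y => (ih Y).trans (ENNReal.ofReal_le_ofReal (key Y))
      _ = ENNReal.ofReal (∫ Y, ∏ u, f u (Y u) ∂(step G X)) := by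
          rw [ofReal_integral_eq_lintegral_ofReal]
          · refine integrable_step_of_bounded G X 1 fun Y => ?_
            rw [abs_of_nonneg (Finset.prod_nonneg fun u _ => hf0 u _)]
            exact Finset.prod_le_one (fun u _ => hf0 u _) fun u _ => hf1 u _
          · exact .of_forall fun Y => Finset.prod_nonneg fun u _ => hf0 u _
      _ ≤ _ := by rw [hint]

end

/-! ### Configurations around a star -/

section

variable {V : Type*} [Fintype V] (G : SimpleGraph V) [DecidableRel G.Adj]

lemma mem_tabu {X : Config V} {u : V} {k : ℕ} :
    k ∈ tabu G X u ↔ ∃ w, G.Adj u w ∧ (X w).isFinal = true ∧ (X w).color = some k := by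
  simp [tabu, and_assoc]

lemma mem_occupied {X : Config V} {u : V} {k : ℕ} :
    k ∈ occupied G X u ↔ ∃ w, G.Adj u w ∧ (X w).color = some k := by
  simp [occupied]

lemma mem_palette {X : Config V} {u : V} {k : ℕ} :
    k ∈ palette G X u ↔ k ≤ G.degree u ∧ k ∉ tabu G X u := by
  simp [palette]

lemma newFinal_eq_true_iff {X : Config V} {u : V} :
    newFinal G X u = true ↔ ∃ k, (X u).color = some k ∧ k ≤ G.degree u ∧
      (((X u).isFinal = true ∧ k ∉ tabu G X u) ∨ ((X u).isFinal = false ∧ k ∉ occupied G X u)) := by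
  unfold newFinal
  cases hc : (X u).color with
  | none => simp
  | some k =>
    cases hf : (X u).isFinal <;> by_cases hd : G.degree u < k <;> simp [hd] <;> omega

/-- The colours in `{0, …, δ(u)}` that do not occur in `ρ` at the neighbours of `u` outside of
`{v} ∪ W`. -/
def coreColors (v : V) (W : Finset V) (ρ : Config V) (u : V) : Set ℕ :=
  {k | k ≤ G.degree u ∧ ∀ x, G.Adj u x → x ≠ v → x ∉ W → (ρ x).color ≠ some k}

/-- `v` and the set `W` of independent neighbours of `v` (its leaves) form a star, and `ρ` is a
legitimate configuration outside of this star. -/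
structure IsStar (v : V) (W : Finset V) (ρ : Config V) : Prop where
  adj : ∀ w ∈ W, G.Adj v w
  indep : ∀ w ∈ W, ∀ w' ∈ W, ¬ G.Adj w w'
  isFinal : ∀ u, u ≠ v → u ∉ W → (ρ u).isFinal = true
  color : ∀ u, u ≠ v → u ∉ W → ∃ k, (ρ u).color = some k ∧ k ≤ G.degree u
  proper : ∀ u x, u ≠ v → u ∉ W → x ≠ v → x ∉ W → G.Adj u x → (ρ u).color ≠ (ρ x).color

/-- In the round that starts in `X`, nothing changes outside of the star, on the star only colours
that are compatible with the rest of the graph are kept or drawn, and `v` and a leaf never both keep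
the same colour. The corrupted configuration has this property. -/
structure IsPrepared (v : V) (W : Finset V) (ρ X : Config V) : Prop where
  out : ∀ u, u ≠ v → u ∉ W → newFinal G X u = true ∧ X u = ρ u
  draw : ∀ u, (u = v ∨ u ∈ W) → newFinal G X u = false →
    ∀ k ∈ palette G X u, k ∈ coreColors G v W ρ u
  keep : ∀ u, (u = v ∨ u ∈ W) → newFinal G X u = true →
    ∃ k ∈ coreColors G v W ρ u, (X u).color = some k
  diff : ∀ w ∈ W, newFinal G X v = true → newFinal G X w = true → (X w).color ≠ (X v).color

/-- The configurations that can occur after at least one round: all conflicts are conflicts between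
`v` and a leaf, and at most one of the two has its flag set. -/
structure IsConfined (v : V) (W : Finset V) (ρ X : Config V) : Prop where
  out : ∀ u, u ≠ v → u ∉ W → X u = ρ u
  col : ∀ u, (u = v ∨ u ∈ W) → ∀ k, (X u).color = some k → k ∈ coreColors G v W ρ u
  ne_none : ∀ u, (u = v ∨ u ∈ W) → (X u).isFinal = true → (X u).color ≠ none
  diff : ∀ w ∈ W, (X v).isFinal = true → (X w).isFinal = true → (X w).color ≠ (X v).color

section

variable {G} {v : V} {W : Finset V} {ρ X Y : Config V}

lemma IsPrepared.isConfined_of_isSuccessor (hS : IsStar G v W ρ) (h : IsPrepared G v W ρ X)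
    (hY : IsSuccessor G X Y) :
    IsConfined G v W ρ Y := by
  have hkeep : ∀ u, newFinal G X u = true → (Y u).color = (X u).color := fun u hu => by
    rw [(hY u).1 hu]
  have hfin : ∀ u, (Y u).isFinal = true → newFinal G X u = true := fun u hu => by
    by_contra hn
    rw [Bool.not_eq_true] at hn
    rw [((hY u).2 hn).1] at hu
    exact Bool.false_ne_true hu
  refine ⟨fun u hv hW => ?_, fun u hu k hk => ?_, fun u hu hf => ?_, fun w hw hfv hfw => ?_⟩
  · obtain ⟨h1, h2⟩ := h.out u hv hW
    rw [(hY u).1 h1, h2]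
    exact NodeState.ext rfl (hS.isFinal u hv hW).symm
  · cases hn : newFinal G X u
    · exact h.draw u hu hn k (((hY u).2 hn).2 k hk)
    · obtain ⟨k', hk', h1⟩ := h.keep u hu hn
      rw [hkeep u hn, h1, Option.some_inj] at hk
      exact hk ▸ hk'
  · obtain ⟨k', hk', h1⟩ := h.keep u hu (hfin u hf)
    simp [hkeep u (hfin u hf), h1]
  · rw [hkeep w (hfin w hfw), hkeep v (hfin v hfv)]
    exact h.diff w hw (hfin v hfv) (hfin w hfw)

/-- In a confined configuration, a leaf keeps its colour if it has one, unless its flag is not set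
and `v` has the same colour. -/
lemma IsConfined.newFinal_leaf (hS : IsStar G v W ρ) (h : IsConfined G v W ρ X) {w : V}
    (hw : w ∈ W) : newFinal G X w = true ↔
      (X w).color ≠ none ∧ ((X w).isFinal = true ∨ (X w).color ≠ (X v).color) := by
  have hadj : G.Adj w v := (hS.adj w hw).symm
  have hnb : ∀ k, (X w).color = some k → ∀ x, G.Adj w x → x ≠ v → (X x).color ≠ some k := by
    intro k hk x hx hxv
    have hxW : x ∉ W := fun hxW => hS.indep w hw x hxW hx
    rw [h.out x hxv hxW]
    exact (h.col w (.inr hw) k hk).2 x hx hxv hxW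
  rw [newFinal_eq_true_iff]
  constructor
  · rintro ⟨k, hk, -, ⟨hf, -⟩ | ⟨-, ho⟩⟩
    · exact ⟨by simp [hk], .inl hf⟩
    · refine ⟨by simp [hk], .inr fun he => ho ?_⟩
      exact (mem_occupied G).2 ⟨v, hadj, he ▸ hk⟩
  · rintro ⟨hc, hor⟩
    obtain ⟨k, hk⟩ := Option.ne_none_iff_exists'.1 hc
    refine ⟨k, hk, (h.col w (.inr hw) k hk).1, ?_⟩
    cases hf : (X w).isFinal
    · refine .inr ⟨rfl, fun ho => ?_⟩
      obtain ⟨x, hx, hxk⟩ := (mem_occupied G).1 ho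
      by_cases hxv : x = v
      · subst hxv
        rcases hor with h1 | h1
        · simp [hf] at h1
        · exact h1 (hk.trans hxk.symm)
      · exact hnb k hk x hx hxv hxk
    · refine .inl ⟨rfl, fun ho => ?_⟩
      obtain ⟨x, hx, hxf, hxk⟩ := (mem_tabu G).1 ho
      by_cases hxv : x = v
      · subst hxv
        exact h.diff w hw hxf hf (hk.trans hxk.symm)
      · exact hnb k hk x hx hxv hxk

lemma IsConfined.newFinal_center (hS : IsStar G v W ρ) (h : IsConfined G v W ρ X) :
    newFinal G X v = true ↔ (X v).color ≠ none ∧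
      ((X v).isFinal = true ∨ ∀ w ∈ W, (X w).color ≠ (X v).color) := by
  have hnb : ∀ k, (X v).color = some k → ∀ x, G.Adj v x → x ∉ W → (X x).color ≠ some k := by
    intro k hk x hx hxW
    rw [h.out x hx.ne' hxW]
    exact (h.col v (.inl rfl) k hk).2 x hx hx.ne' hxW
  rw [newFinal_eq_true_iff]
  constructor
  · rintro ⟨k, hk, -, ⟨hf, -⟩ | ⟨-, ho⟩⟩
    · exact ⟨by simp [hk], .inl hf⟩
    · refine ⟨by simp [hk], .inr fun w hw he => ho ?_⟩
      exact (mem_occupied G).2 ⟨w, hS.adj w hw, he.trans hk⟩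
  · rintro ⟨hc, hor⟩
    obtain ⟨k, hk⟩ := Option.ne_none_iff_exists'.1 hc
    refine ⟨k, hk, (h.col v (.inl rfl) k hk).1, ?_⟩
    cases hf : (X v).isFinal
    · refine .inr ⟨rfl, fun ho => ?_⟩
      obtain ⟨x, hx, hxk⟩ := (mem_occupied G).1 ho
      by_cases hxW : x ∈ W
      · rcases hor with h1 | h1
        · simp [hf] at h1
        · exact h1 x hxW (hxk.trans hk.symm)
      · exact hnb k hk x hx hxW hxk
    · refine .inl ⟨rfl, fun ho => ?_⟩
      obtain ⟨x, hx, hxf, hxk⟩ := (mem_tabu G).1 ho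
      by_cases hxW : x ∈ W
      · exact h.diff x hxW hf hxf (hxk.trans hk.symm)
      · exact hnb k hk x hx hxW hxk

lemma IsConfined.isPrepared (hS : IsStar G v W ρ) (h : IsConfined G v W ρ X) :
    IsPrepared G v W ρ X := by
  refine ⟨fun u hv hW => ⟨?_, h.out u hv hW⟩, fun u hu hn k hk => ?_, fun u hu hn => ?_,
    fun w hw hv hw' => ?_⟩
  · obtain ⟨k, hk, hd⟩ := hS.color u hv hW
    have hX := h.out u hv hW
    rw [newFinal_eq_true_iff]
    refine ⟨k, by rw [hX, hk], hd, .inl ⟨by rw [hX, hS.isFinal u hv hW], fun ht => ?_⟩⟩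
    obtain ⟨x, hx, -, hxk⟩ := (mem_tabu G).1 ht
    by_cases hxC : x = v ∨ x ∈ W
    · exact (h.col x hxC k hxk).2 u hx.symm hv hW hk
    · push Not at hxC
      rw [h.out x hxC.1 hxC.2] at hxk
      exact hS.proper u x hv hW hxC.1 hxC.2 hx (hk.trans hxk.symm)
  · obtain ⟨h1, h2⟩ := (mem_palette G).1 hk
    refine ⟨h1, fun x hx hxv hxW hxk => h2 ((mem_tabu G).2 ⟨x, hx, ?_, ?_⟩)⟩
    · rw [h.out x hxv hxW, hS.isFinal x hxv hxW]
    · rw [h.out x hxv hxW, hxk]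
  · obtain ⟨k, hk, -⟩ := (newFinal_eq_true_iff G).1 hn
    exact ⟨k, h.col u hu k hk, hk⟩
  · rw [h.newFinal_leaf hS hw] at hw'
    rw [h.newFinal_center hS] at hv
    rcases hv.2 with h1 | h1
    · rcases hw'.2 with h2 | h2
      · exact h.diff w hw h1 h2
      · exact h2
    · exact h1 w hw

lemma IsConfined.legitimate (hS : IsStar G v W ρ) (h : IsConfined G v W ρ X)
    (hf : ∀ u, (u = v ∨ u ∈ W) → (X u).isFinal = true) : Legitimate G X := by
  have hout : ∀ u, ¬ (u = v ∨ u ∈ W) → X u = ρ u := fun u hu => by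
    push Not at hu; exact h.out u hu.1 hu.2
  have hmix : ∀ u x, (u = v ∨ u ∈ W) → ¬ (x = v ∨ x ∈ W) → G.Adj u x →
      (X u).color ≠ (X x).color := by
    intro u x hu hx hux he
    obtain ⟨k, hk⟩ := Option.ne_none_iff_exists'.1 (h.ne_none u hu (hf u hu))
    rw [hout x hx, hk] at he
    push Not at hx
    exact (h.col u hu k hk).2 x hux hx.1 hx.2 he.symm
  refine ⟨fun u => ?_, fun u x hux => ?_⟩
  · by_cases hu : u = v ∨ u ∈ W
    · refine ⟨hf u hu, ?_⟩
      obtain ⟨k, hk⟩ := Option.ne_none_iff_exists'.1 (h.ne_none u hu (hf u hu))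
      exact ⟨k, hk, (h.col u hu k hk).1⟩
    · rw [hout u hu]
      push Not at hu
      exact ⟨hS.isFinal u hu.1 hu.2, hS.color u hu.1 hu.2⟩
  · by_cases hu : u = v ∨ u ∈ W <;> by_cases hx : x = v ∨ x ∈ W
    · rcases hu with rfl | hu
      · rcases hx with rfl | hx
        · exact absurd hux (G.irrefl)
        · exact (h.diff x hx (hf _ (.inl rfl)) (hf _ (.inr hx))).symm
      · rcases hx with rfl | hx
        · exact h.diff u hu (hf _ (.inl rfl)) (hf _ (.inr hu))
        · exact absurd hux (hS.indep u hu x hx)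
    · exact hmix u x hu hx hux
    · exact (hmix x u hx hu hux.symm).symm
    · rw [hout u hu, hout x hx]
      push Not at hu hx
      exact hS.proper u x hu.1 hu.2 hx.1 hx.2 hux

end

end

/-! ### The corrupted configuration -/

section

variable {V : Type*} [Fintype V] (G : SimpleGraph V) [DecidableRel G.Adj]

lemma card_tabu_le_card_final (X : Config V) (u : V) :
    (tabu G X u).card ≤ {w ∈ G.neighborFinset u | (X w).isFinal = true}.card := by
  refine Finset.card_biUnion_le.trans
    ((Finset.sum_le_card_nsmul _ _ 1 fun w _ => ?_).trans (by simp))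
  cases (X w).color <;> simp

lemma degree_lt_card_palette_add (X : Config V) (u : V) :
    G.degree u < (palette G X u).card + (tabu G X u).card := by
  have h := Finset.le_card_sdiff (tabu G X u) (Finset.range (G.degree u + 1))
  rw [Finset.card_range] at h
  unfold palette
  omega

/-- Neighbours whose flag is not set do not make any colour tabu. -/
lemma card_lt_card_palette {v : V} {W : Finset V} (hW : ∀ w ∈ W, G.Adj v w) (X : Config V) :
    {w ∈ W | (X w).isFinal = false}.card < (palette G X v).card := by
  classical
  have h1 := degree_lt_card_palette_add G X v
  have h2 := card_tabu_le_card_final G X v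
  have h3 : {w ∈ W | (X w).isFinal = false}.card +
      {w ∈ G.neighborFinset v | (X w).isFinal = true}.card ≤ G.degree v := by
    rw [← G.card_neighborFinset_eq_degree, ← Finset.card_union_of_disjoint]
    · refine Finset.card_le_card (Finset.union_subset (fun w hw => ?_) (Finset.filter_subset _ _))
      simpa using hW w (Finset.mem_filter.1 hw).1
    · refine Finset.disjoint_filter_filter' _ _ ?_ |>.mono le_rfl le_rfl
      rw [Pi.disjoint_iff]
      intro w
      simp
  omega

/-- Neighbours of the same colour make at most one colour tabu. -/
lemma card_le_card_palette {v : V} {W : Finset V} (hW : ∀ w ∈ W, G.Adj v w) (X : Config V)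
    (c : Option ℕ) (hc : ∀ w ∈ W, (X w).color = c) (hne : W.Nonempty) :
    W.card ≤ (palette G X v).card := by
  classical
  have h1 := degree_lt_card_palette_add G X v
  have hsub : tabu G X v ⊆ ((G.neighborFinset v \ W).biUnion fun w => (X w).color.toFinset) ∪
      c.toFinset := by
    intro k hk
    obtain ⟨x, hx, -, hxk⟩ := (mem_tabu G).1 hk
    by_cases hxW : x ∈ W
    · refine Finset.mem_union_right _ ?_
      rw [← hc x hxW, hxk]; simp
    · refine Finset.mem_union_left _ (Finset.mem_biUnion.2 ⟨x, by simp [hx, hxW], by simp [hxk]⟩)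
  have hopt : ∀ o : Option ℕ, o.toFinset.card ≤ 1 := fun o => by cases o <;> simp
  have h2 : (tabu G X v).card ≤ (G.neighborFinset v \ W).card + 1 := by
    refine (Finset.card_le_card hsub).trans ((Finset.card_union_le _ _).trans ?_)
    refine add_le_add (Finset.card_biUnion_le.trans ?_) (hopt c)
    exact (Finset.sum_le_card_nsmul _ _ 1 fun w _ => hopt _).trans (by simp)
  have hWsub : W ⊆ G.neighborFinset v := fun w hw => by simpa using hW w hw
  rw [Finset.card_sdiff_of_subset hWsub, G.card_neighborFinset_eq_degree] at h2
  have h3 := Finset.card_le_card hWsub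
  rw [G.card_neighborFinset_eq_degree] at h3
  have h4 := hne.card_pos
  omega

lemma card_le_indepDegree {V : Type*} [Fintype V] (G : SimpleGraph V) {v : V} {W : Finset V}
    (hW : ∀ w ∈ W, G.Adj v w) (hI : ∀ w ∈ W, ∀ w' ∈ W, ¬ G.Adj w w') :
    W.card ≤ indepDegree G v := by
  classical
  let s : Finset (G.neighborSet v) := W.attach.image fun w => ⟨w.1, hW w.1 w.2⟩
  have hcard : s.card = W.card := by
    rw [Finset.card_image_of_injective, Finset.card_attach]
    intro a b hab
    exact Subtype.ext (congrArg (fun z => z.1) hab)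
  rw [← hcard]
  refine SimpleGraph.IsIndepSet.card_le_indepNum (t := s) ?_
  intro a ha b hb _ hab
  obtain ⟨x, -, rfl⟩ := Finset.mem_image.1 (Finset.mem_coe.1 ha)
  obtain ⟨y, -, rfl⟩ := Finset.mem_image.1 (Finset.mem_coe.1 hb)
  exact hI x.1 x.2 y.1 y.2 hab

variable {G} {v : V} {W : Finset V} {ρ σ : Config V}

lemma Legitimate.isStar (hρ : Legitimate G ρ) (hW : ∀ w ∈ W, G.Adj v w) (c : Option ℕ)
    (hc : ∀ w ∈ W, (ρ w).color = c) : IsStar G v W ρ where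
  adj := hW
  indep w hw w' hw' h := hρ.2 w w' h ((hc w hw).trans (hc w' hw').symm)
  isFinal u _ _ := (hρ.1 u).1
  color u _ _ := (hρ.1 u).2
  proper u x _ _ _ _ h := hρ.2 u x h

lemma MemoryCorruption.isPrepared_of_newFinal (hρ : Legitimate G ρ) (hσ : MemoryCorruption ρ σ v)
    (h : newFinal G σ v = true) : IsPrepared G v ∅ ρ σ := by
  obtain ⟨c, hc, hcd, hor⟩ := (newFinal_eq_true_iff G).1 h
  have hnc : ∀ x, G.Adj v x → (σ x).color ≠ some c := by
    intro x hx hxc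
    rcases hor with ⟨-, ht⟩ | ⟨-, ho⟩
    · exact ht ((mem_tabu G).2 ⟨x, hx, by rw [hσ.2 x hx.ne', (hρ.1 x).1], hxc⟩)
    · exact ho ((mem_occupied G).2 ⟨x, hx, hxc⟩)
  refine ⟨fun u hv _ => ⟨?_, hσ.2 u hv⟩, fun u hu hn => ?_, fun u hu _ => ?_, by simp⟩
  · obtain ⟨k, hk, hkd⟩ := (hρ.1 u).2
    rw [newFinal_eq_true_iff, hσ.2 u hv]
    refine ⟨k, hk, hkd, .inl ⟨(hρ.1 u).1, fun ht => ?_⟩⟩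
    obtain ⟨x, hx, -, hxk⟩ := (mem_tabu G).1 ht
    by_cases hxv : x = v
    · subst hxv
      exact hnc u hx.symm (by rw [hσ.2 u hv, hk, ← hxk, hc])
    · rw [hσ.2 x hxv] at hxk
      exact hρ.2 u x hx (hk.trans hxk.symm)
  · obtain rfl : u = v := by simpa using hu
    simp [h] at hn
  · obtain rfl : u = v := by simpa using hu
    exact ⟨c, ⟨hcd, fun x hx hxu _ => hσ.2 x hxu ▸ hnc x hx⟩, hc⟩

/-- A neighbour whose colour collides with the corrupted one draws a new colour in the first round.
-/
lemma MemoryCorruption.newFinal_eq_false (hρ : Legitimate G ρ) (hσ : MemoryCorruption ρ σ v)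
    {w : V} (hw : G.Adj v w) (hf : (σ v).isFinal = true) (hc : (σ w).color = (σ v).color) :
    newFinal G σ w = false := by
  by_contra hn
  rw [Bool.not_eq_false, newFinal_eq_true_iff] at hn
  obtain ⟨k, hk, -, ⟨-, ht⟩ | ⟨h0, -⟩⟩ := hn
  · exact ht ((mem_tabu G).2 ⟨v, hw.symm, hf, hc ▸ hk⟩)
  · rw [hσ.2 w hw.ne', (hρ.1 w).1] at h0
    exact Bool.false_ne_true h0.symm

lemma MemoryCorruption.isPrepared_of_not_newFinal (hρ : Legitimate G ρ)
    (hσ : MemoryCorruption ρ σ v) (h : newFinal G σ v = false)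
    (hW : ∀ w, w ∈ W ↔ G.Adj v w ∧ (σ v).isFinal = true ∧ (σ w).color = (σ v).color) :
    IsPrepared G v W ρ σ := by
  have hn : ∀ u, (u = v ∨ u ∈ W) → newFinal G σ u = false := by
    rintro u (rfl | hu)
    · exact h
    · obtain ⟨h1, h2, h3⟩ := (hW u).1 hu
      exact hσ.newFinal_eq_false hρ h1 h2 h3
  refine ⟨fun u hv huW => ⟨?_, hσ.2 u hv⟩, fun u hu _ k hk => ?_, fun u hu hu' => ?_,
    fun w hw hv => ?_⟩
  · obtain ⟨k, hk, hkd⟩ := (hρ.1 u).2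
    rw [newFinal_eq_true_iff, hσ.2 u hv]
    refine ⟨k, hk, hkd, .inl ⟨(hρ.1 u).1, fun ht => ?_⟩⟩
    obtain ⟨x, hx, hxf, hxk⟩ := (mem_tabu G).1 ht
    by_cases hxv : x = v
    · subst hxv
      exact huW ((hW u).2 ⟨hx.symm, hxf, by rw [hσ.2 u hv, hk, hxk]⟩)
    · rw [hσ.2 x hxv] at hxk
      exact hρ.2 u x hx (hk.trans hxk.symm)
  · obtain ⟨h1, h2⟩ := (mem_palette G).1 hk
    refine ⟨h1, fun x hx hxv _ hxk => h2 ((mem_tabu G).2 ⟨x, hx, ?_, ?_⟩)⟩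
    · rw [hσ.2 x hxv, (hρ.1 x).1]
    · rw [hσ.2 x hxv, hxk]
  · simp [hn u hu] at hu'
  · simp [h] at hv

end

/-! ### The constants of the potential -/

section

/-- Intercepts of the lines that define `excess`. The values are such that `roundBound_le_excess`
holds (with equality for `m = 1` and `a = 0`), while `initBound` stays small. -/
def coefA : ℕ → ℝ
  | 0 => 1
  | 1 => 5
  | 2 => 13 / 5
  | 3 => 27 / 10
  | 4 => 18 / 5
  | 5 => 17 / 5
  | n + 6 => 5 + 3 / 10 * n

/-- Slopes of the lines that define `excess`. -/
def coefS : ℕ → ℝ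
  | 0 => 0
  | 1 => 0
  | 2 => 29 / 10
  | 3 => 31 / 10
  | 4 => 14 / 5
  | 5 => 3
  | _ + 6 => 13 / 5

/-- The share of the centre in the potential, if it is pending, `m` leaves are pending and the flags
of `M` leaves are not set. For `m = 0` it is `roundBound 0 M (M + 1)`, and otherwise it is linear in
`m`, so that its mean over a round is explicit. -/
def excess (M m : ℕ) : ℝ :=
  if m = 0 then 1 + M / (M + 1) else coefA M + coefS M * m

/-- The mean of `excess m B` for a binomial variable `B` with parameters `m` and `1/2`. -/
def meanExcess (m : ℕ) : ℝ :=
  coefA m + coefS m * (m / 2) - (coefA m - (1 + m / (m + 1))) * (1 / 2) ^ m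

/-- The amount by which twice the mean of the potential after a round in which the centre draws from
a palette of `K` colours can exceed `m`, where `m` leaves are pending and `a` leaves are about to
set their flags. In the first term, one half is for leaves that draw the same colour as the centre,
and one half for leaves that draw `⊥` and may draw the new colour of the centre later; the second
term is for a centre that draws `⊥` or the colour of one of the `a` leaves, and the third one for a
centre that draws the same colour as a pending leaf. -/
def roundBound (m a : ℕ) (K : ℝ) : ℝ :=
  m / K + (1 + a / K) * meanExcess m + m / (2 * K) * (coefA m + coefS m * ((m + 1) / 2))

lemma coefA_nonneg (n : ℕ) : 0 ≤ coefA n := by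
  unfold coefA; split <;> positivity

lemma coefS_nonneg (n : ℕ) : 0 ≤ coefS n := by
  unfold coefS; split <;> norm_num

lemma coefA_ge {m : ℕ} (hm : 6 ≤ m) : 1 + (m : ℝ) / (m + 1) ≤ coefA m := by
  obtain ⟨k, rfl⟩ := Nat.exists_eq_add_of_le' hm
  have h : ((k + 6 : ℕ) : ℝ) / ((k + 6 : ℕ) + 1) ≤ 1 := by
    rw [div_le_one (by positivity)]; linarith
  have : coefA (k + 6) = 5 + 3 / 10 * k := rfl
  rw [this]
  nlinarith [(Nat.cast_nonneg k : (0 : ℝ) ≤ k)]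

lemma excess_nonneg (M m : ℕ) : 0 ≤ excess M m := by
  unfold excess
  have h1 := coefA_nonneg M
  have h2 := coefS_nonneg M
  split_ifs <;> positivity

lemma meanExcess_nonneg (m : ℕ) : 0 ≤ meanExcess m := by
  have h1 := coefA_nonneg m
  have h2 := coefS_nonneg m
  have h3 : (1 / 2 : ℝ) ^ m ≤ 1 := pow_le_one₀ (by norm_num) (by norm_num)
  have h4 : 0 ≤ (1 + (m : ℝ) / (m + 1)) * (1 / 2) ^ m := by positivity
  have h5 : 0 ≤ coefS m * (m / 2) := by positivity
  unfold meanExcess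
  nlinarith

lemma meanExcess_le {m : ℕ} (hm : 6 ≤ m) : meanExcess m ≤ coefA m + coefS m * (m / 2) := by
  have h := coefA_ge hm
  have h3 : (0 : ℝ) ≤ (1 / 2 : ℝ) ^ m := by positivity
  unfold meanExcess
  nlinarith

lemma roundBound_anti {m a : ℕ} {K K' : ℝ} (hK : 0 < K) (h : K ≤ K') :
    roundBound m a K' ≤ roundBound m a K := by
  have h1 := coefA_nonneg m
  have h2 := coefS_nonneg m
  have h3 := meanExcess_nonneg m
  unfold roundBound
  gcongr

/-- The inequality behind the choice of `coefA` and `coefS`: `m + a` leaves without flag leave at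
least `m + a + 1` colours to the centre, and then the potential halves. -/
lemma roundBound_le_excess (m a : ℕ) : roundBound m a (m + a + 1) ≤ excess (m + a) m := by
  have hK : (0 : ℝ) < m + a + 1 := by positivity
  have key : m + (m + a + 1 + a) * meanExcess m + m / 2 * (coefA m + coefS m * ((m + 1) / 2)) ≤
      (m + a + 1) * excess (m + a) m → roundBound m a (m + a + 1) ≤ excess (m + a) m := by
    intro h
    have : roundBound m a (m + a + 1) = (m + (m + a + 1 + a) * meanExcess m +
        m / 2 * (coefA m + coefS m * ((m + 1) / 2))) / (m + a + 1) := by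
      unfold roundBound; field_simp
    rw [this, div_le_iff₀ hK]
    linarith
  apply key
  rcases lt_or_ge m 7 with hm | hm
  · rcases lt_or_ge (m + a) 6 with hM | hM
    · have ha : a < 6 := by omega
      clear key hK
      interval_cases m <;> interval_cases a <;> first | omega | skip
      all_goals norm_num [meanExcess, excess, coefA, coefS]
    · obtain ⟨b, hb⟩ := Nat.exists_eq_add_of_le' hM
      have hA : coefA (m + a) = 5 + 3 / 10 * b := by rw [hb]; rfl
      have hS : coefS (m + a) = 13 / 5 := by rw [hb]; rfl
      have ha : (a : ℝ) = b + 6 - m := by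
        have : ((m + a : ℕ) : ℝ) = b + 6 := by rw [hb]; push_cast; ring
        push_cast at this; linarith
      have hb0 : (0 : ℝ) ≤ b := Nat.cast_nonneg b
      unfold excess
      rw [hA, hS]
      interval_cases m
      · norm_num [meanExcess, coefA, coefS]
        field_simp
        linarith
      all_goals
        norm_num [meanExcess, coefA, coefS] at ha ⊢
        rw [ha]
        nlinarith [mul_nonneg hb0 hb0, sq_nonneg ((b : ℝ) - 5)]
  · obtain ⟨u, rfl⟩ := Nat.exists_eq_add_of_le' hm
    have hA : coefA (u + 7) = 5 + 3 / 10 * (u + 1) := by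
      change (5 : ℝ) + 3 / 10 * ((u + 1 : ℕ) : ℝ) = _; push_cast; ring
    have hS : coefS (u + 7) = 13 / 5 := rfl
    have hA' : coefA (u + 7 + a) = 5 + 3 / 10 * (u + a + 1) := by
      rw [show u + 7 + a = (u + a + 1) + 6 by ring]
      change (5 : ℝ) + 3 / 10 * ((u + a + 1 : ℕ) : ℝ) = _; push_cast; ring
    have hS' : coefS (u + 7 + a) = 13 / 5 := by
      rw [show u + 7 + a = (u + a + 1) + 6 by ring]; rfl
    have hE := meanExcess_le (m := u + 7) (by omega)
    rw [hA, hS] at hE ⊢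
    have hex : excess (u + 7 + a) (u + 7) = 5 + 3 / 10 * (u + a + 1) + 13 / 5 * (u + 7 : ℕ) := by
      rw [excess, if_neg (by omega), hA', hS']
    rw [hex]
    push_cast at hE ⊢
    have hu : (0 : ℝ) ≤ u := Nat.cast_nonneg u
    have ha : (0 : ℝ) ≤ a := Nat.cast_nonneg a
    nlinarith [mul_le_mul_of_nonneg_left hE (by positivity : (0 : ℝ) ≤ u + 7 + a + 1 + a),
      mul_nonneg hu hu, mul_nonneg hu ha, sq_nonneg ((a : ℝ) - 5)]

/-- The constant in the tail bound for a fault after which `n` neighbours are in conflict with the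
corrupted node. -/
def initBound (n : ℕ) : ℝ := if n = 0 then 1 else 17 / 5 * n + 33 / 5

lemma roundBound_le_initBound {n : ℕ} {K : ℝ} (hn : (n : ℝ) ≤ K) :
    n + roundBound n 0 K ≤ initBound n := by
  rcases Nat.eq_zero_or_pos n with rfl | hpos
  · norm_num [roundBound, initBound, meanExcess, coefA, coefS]
  have hn0 : (0 : ℝ) < n := by exact_mod_cast hpos
  have h1 := roundBound_anti (m := n) (a := 0) hn0 hn
  have h2 : roundBound n 0 n =
      1 + meanExcess n + 1 / 2 * (coefA n + coefS n * ((n + 1) / 2)) := by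
    unfold roundBound; field_simp; norm_num; ring
  rw [initBound, if_neg hpos.ne']
  refine (add_le_add_right (h1.trans_eq h2) _).trans ?_
  rcases lt_or_ge n 6 with h | h
  · interval_cases n <;> norm_num [meanExcess, coefA, coefS]
  · have hE := meanExcess_le h
    obtain ⟨u, rfl⟩ := Nat.exists_eq_add_of_le' h
    have hA : coefA (u + 6) = 5 + 3 / 10 * u := rfl
    have hS : coefS (u + 6) = 13 / 5 := rfl
    rw [hA, hS] at hE ⊢
    push_cast at hE ⊢
    linarith

end

/-! ### The potential, and rounds in which the centre keeps its colour -/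

section

variable {V : Type*} [Fintype V] (G : SimpleGraph V) [DecidableRel G.Adj]

/-- The leaves that draw a new colour in the round that starts in `X`. -/
def pendingLeaves (W : Finset V) (X : Config V) : Finset V := {w ∈ W | newFinal G X w = false}

/-- The potential of a configuration with respect to the star with centre `v` and leaves `W`. Every
pending leaf counts `1`. If `v` is pending, then its share is added. If `v` keeps its colour, then a
pending leaf counts more by twice the probability that it draws the colour of `v`, which is zero
once the flag of `v` is set. -/
def potential (v : V) (W : Finset V) (X : Config V) : ℝ :=
  if newFinal G X v = true then
    ∑ w ∈ pendingLeaves G W X, (1 + 2 * colorProb G X w (X v).color)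
  else (pendingLeaves G W X).card +
    excess {w ∈ W | (X w).isFinal = false}.card (pendingLeaves G W X).card

lemma potential_nonneg (v : V) (W : Finset V) (X : Config V) : 0 ≤ potential G v W X := by
  unfold potential
  split_ifs
  · exact Finset.sum_nonneg fun w _ => by linarith [colorProb_nonneg G X w (X v).color]
  · exact add_nonneg (Nat.cast_nonneg _) (excess_nonneg _ _)

lemma one_le_card_add_excess (M m : ℕ) : 1 ≤ m + excess M m := by
  rcases Nat.eq_zero_or_pos m with rfl | h
  · have : (0 : ℝ) ≤ M / (M + 1) := by positivity
    simp [excess, this]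
  · have : (1 : ℝ) ≤ m := by exact_mod_cast h
    linarith [excess_nonneg M m]

lemma integrable_indicator_step (X : Config V) (s : Set (Config V)) :
    Integrable (s.indicator (1 : Config V → ℝ)) (step G X) :=
  (integrable_const (1 : ℝ)).indicator (Set.to_countable _).measurableSet

lemma integral_indicator_step (X : Config V) (s : Set (Config V)) :
    ∫ Y, s.indicator (1 : Config V → ℝ) Y ∂(step G X) = (step G X).real s :=
  integral_indicator_one (Set.to_countable _).measurableSet

variable {G}

lemma step_real_colors {X : Config V} {s : Finset V} (hs : ∀ u ∈ s, newFinal G X u = false)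
    (c : V → Option ℕ) :
    (step G X).real {Y | ∀ u ∈ s, (Y u).color = c u} = ∏ u ∈ s, colorProb G X u (c u) := by
  rw [← Finset.prod_congr rfl fun u hu => nodeStep_real_color G (hs u hu) (c u)]
  exact step_real_rect G X s fun u => {s | s.color = c u}

lemma step_real_color {X : Config V} {u : V} (hu : newFinal G X u = false) (c : Option ℕ) :
    (step G X).real {Y | (Y u).color = c} = colorProb G X u c := by
  have h := step_real_colors (G := G) (X := X) (s := {u}) (by simpa using hu) fun _ => c
  simpa using h

lemma step_real_color₂ {X : Config V} {u w : V} (hu : newFinal G X u = false)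
    (hw : newFinal G X w = false) (huw : u ≠ w) (c d : Option ℕ) :
    (step G X).real {Y | (Y u).color = c ∧ (Y w).color = d} =
      colorProb G X u c * colorProb G X w d := by
  classical
  have h := step_real_colors (G := G) (X := X) (s := {u, w}) (by simp [hu, hw])
    fun x => if x = u then c else d
  rw [Finset.prod_pair huw] at h
  simpa [huw.symm] using h

lemma step_real_color₃ {X : Config V} {u w x : V} (hu : newFinal G X u = false)
    (hw : newFinal G X w = false) (hx : newFinal G X x = false) (huw : u ≠ w) (hux : u ≠ x)
    (hwx : w ≠ x) (c d e : Option ℕ) :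
    (step G X).real {Y | (Y u).color = c ∧ (Y w).color = d ∧ (Y x).color = e} =
      colorProb G X u c * (colorProb G X w d * colorProb G X x e) := by
  classical
  have h := step_real_colors (G := G) (X := X) (s := {u, w, x}) (by simp [hu, hw, hx])
    fun y => if y = u then c else if y = w then d else e
  rw [Finset.prod_insert (by simp [huw, hux]), Finset.prod_pair hwx] at h
  simpa [huw.symm, hux.symm, hwx.symm] using h

lemma step_real_color_ne_none {X : Config V} {v : V} {P : Finset V} (hv : newFinal G X v = false)
    (hP : ∀ w ∈ P, newFinal G X w = false) (hvP : v ∉ P) (c : Option ℕ) :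
    (step G X).real {Y | (Y v).color = c ∧ ∀ w ∈ P, (Y w).color ≠ none} =
      colorProb G X v c * (1 / 2) ^ P.card := by
  classical
  have h := step_real_rect G X (insert v P)
    fun u => if u = v then {s | s.color = c} else {s | s.color ≠ none}
  rw [Finset.prod_insert hvP, Finset.prod_congr (g := fun _ => (1 / 2 : ℝ)) rfl, if_pos rfl,
    Finset.prod_const, nodeStep_real_color G hv] at h
  · rw [← h]
    congr 1
    ext Y
    simp only [Set.mem_ofPred_eq, Finset.forall_mem_insert, if_true]
    refine and_congr Iff.rfl (forall₂_congr fun w hw => ?_)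
    rw [if_neg (ne_of_mem_of_not_mem hw hvP)]
    rfl
  · intro w hw
    rw [if_neg (ne_of_mem_of_not_mem hw hvP)]
    exact nodeStep_real_color_ne_none G (hP w hw)

lemma sum_colorProb_le {X : Config V} {u : V} (s : Finset ℕ) :
    ∑ k ∈ s, colorProb G X u (some k) ≤ 1 / 2 := by
  classical
  have hK : (0 : ℝ) < (palette G X u).card := by
    exact_mod_cast (palette_nonempty G X u).card_pos
  simp only [colorProb_some]
  rw [← Finset.sum_filter, Finset.sum_const, nsmul_eq_mul, mul_one_div, div_le_iff₀ (by positivity)]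
  have : ((s.filter (· ∈ palette G X u)).card : ℝ) ≤ (palette G X u).card := by
    exact_mod_cast Finset.card_le_card fun k hk => (Finset.mem_filter.1 hk).2
  linarith

lemma colorProb_some_le {X : Config V} {u : V} (k : ℕ) :
    colorProb G X u (some k) ≤ 1 / (2 * (palette G X u).card) := by
  rw [colorProb_some]
  split_ifs
  · exact le_rfl
  · positivity

/-- If `f` is dominated by a function `g` with mean at most `b`, then so is its mean. -/
lemma lintegral_step_ofReal_le {X : Config V} {f g : Config V → ℝ} {b : ℝ} (hf : ∀ Y, 0 ≤ f Y)
    (hg : Integrable g (step G X)) (hfg : ∀ᵐ Y ∂(step G X), f Y ≤ g Y)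
    (hb : ∫ Y, g Y ∂(step G X) ≤ b) :
    ∫⁻ Y, ENNReal.ofReal (f Y) ∂(step G X) ≤ ENNReal.ofReal b := by
  calc ∫⁻ Y, ENNReal.ofReal (f Y) ∂(step G X) ≤ ∫⁻ Y, ENNReal.ofReal (g Y) ∂(step G X) :=
        lintegral_mono_ae (hfg.mono fun Y h => ENNReal.ofReal_le_ofReal h)
    _ = ENNReal.ofReal (∫ Y, g Y ∂(step G X)) :=
        (ofReal_integral_eq_lintegral_ofReal hg (hfg.mono fun Y h => (hf Y).trans h)).symm
    _ ≤ _ := ENNReal.ofReal_le_ofReal hb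

variable {v : V} {W : Finset V} {ρ X Y : Config V}

lemma mem_pendingLeaves {w : V} : w ∈ pendingLeaves G W X ↔ w ∈ W ∧ newFinal G X w = false := by
  simp [pendingLeaves]

/-- A leaf whose flag is set never becomes pending, and a pending leaf stays pending if and only if
it draws `⊥` or has the same colour as `v` after the round. -/
lemma IsPrepared.mem_pendingLeaves_iff (hS : IsStar G v W ρ) (h : IsPrepared G v W ρ X)
    (hY : IsSuccessor G X Y) {w : V} : w ∈ pendingLeaves G W Y ↔
      w ∈ pendingLeaves G W X ∧ ((Y w).color = none ∨ (Y w).color = (Y v).color) := by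
  have hc := h.isConfined_of_isSuccessor hS hY
  rw [mem_pendingLeaves, mem_pendingLeaves, and_assoc, and_congr_right_iff]
  intro hw
  rw [← Bool.not_eq_true, hc.newFinal_leaf hS hw]
  cases hn : newFinal G X w
  · have := ((hY w).2 hn).1
    simp only [this]
    by_cases h1 : (Y w).color = none <;> simp [h1]
  · have h1 : (Y w).isFinal = true := by rw [(hY w).1 hn]
    simp [hc.ne_none w (.inr hw) h1, h1]

/-- The mean of the potential after a round in which `v` keeps its colour. -/
lemma IsPrepared.lintegral_potential_le_of_newFinal (hS : IsStar G v W ρ)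
    (h : IsPrepared G v W ρ X) (hv : newFinal G X v = true) :
    ∫⁻ Y, ENNReal.ofReal (potential G v W Y) ∂(step G X) ≤
      ENNReal.ofReal (1 / 2 * potential G v W X) := by
  set c := (X v).color with hcdef
  have hcne : c ≠ none := by
    obtain ⟨k, -, hk⟩ := h.keep v (.inl rfl) hv
    simp [hcdef, hk]
  refine lintegral_step_ofReal_le (potential_nonneg G v W)
    (g := fun Y => ∑ w ∈ pendingLeaves G W X,
      ({Z : Config V | (Z w).color = none}.indicator (1 : Config V → ℝ) Y +
        {Z : Config V | (Z w).color = c}.indicator (1 : Config V → ℝ) Y)) ?_ ?_ ?_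
  · exact integrable_finsetSum _ fun w _ => (integrable_indicator_step G X _).add
      (integrable_indicator_step G X _)
  · filter_upwards [ae_isSuccessor G X] with Y hY
    have hconf := h.isConfined_of_isSuccessor hS hY
    have hYv := (hY v).1 hv
    have hYc : (Y v).color = c := by rw [hYv]
    have hYf : (Y v).isFinal = true := by rw [hYv]
    have hn : newFinal G Y v = true :=
      (hconf.newFinal_center hS).2 ⟨hYc ▸ hcne, .inl hYf⟩
    rw [potential, if_pos hn]
    have h0 : ∀ w ∈ pendingLeaves G W Y, 1 + 2 * colorProb G Y w (Y v).color = 1 := by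
      intro w hw
      obtain ⟨k, hk⟩ := Option.ne_none_iff_exists'.1 hcne
      have : k ∉ palette G Y w := fun hp => ((mem_palette G).1 hp).2 ((mem_tabu G).2
        ⟨v, (hS.adj w (mem_pendingLeaves.1 hw).1).symm, hYf, hYc.trans hk⟩)
      rw [hYc, hk, colorProb_some, if_neg this]; norm_num
    rw [Finset.sum_congr rfl h0]
    have hsub : pendingLeaves G W Y ⊆ pendingLeaves G W X := fun w hw =>
      ((h.mem_pendingLeaves_iff hS hY).1 hw).1
    refine (Finset.sum_le_sum fun w hw => ?_).trans
      (Finset.sum_le_sum_of_subset_of_nonneg hsub fun w _ _ => ?_)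
    · obtain ⟨-, h1 | h1⟩ := (h.mem_pendingLeaves_iff hS hY).1 hw
      · simp [h1, hcne.symm]
      · rw [hYc] at h1
        simp [h1, hcne]
    · exact add_nonneg (Set.indicator_nonneg (by simp) _) (Set.indicator_nonneg (by simp) _)
  · rw [integral_finsetSum (f := fun w Y =>
      ({Z : Config V | (Z w).color = none}.indicator (1 : Config V → ℝ) Y +
        {Z : Config V | (Z w).color = c}.indicator (1 : Config V → ℝ) Y)) _
      fun w _ => (integrable_indicator_step G X _).add (integrable_indicator_step G X _),
      potential, if_pos hv, Finset.mul_sum]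
    refine (Finset.sum_congr rfl fun w hw => ?_).le
    have hw' := (mem_pendingLeaves.1 hw).2
    rw [integral_add (integrable_indicator_step G X _) (integrable_indicator_step G X _),
      integral_indicator_step, integral_indicator_step, step_real_color hw', step_real_color hw',
      colorProb_none]
    ring

end

/-! ### Terms that bound the potential after a round in which the centre draws a colour -/

section

variable {V : Type*} [Fintype V] (G : SimpleGraph V) [DecidableRel G.Adj]

open Classical in
/-- The probability with which a pending leaf `w` draws the colour `k` while the flag of `v` is not
set. Then the palette of `w` depends only on the configuration outside of the star. -/
def leafProb (v : V) (W : Finset V) (ρ : Config V) (w : V) (k : ℕ) : ℝ :=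
  if k ∈ coreColors G v W ρ w then 1 / (2 * (coreColors G v W ρ w).ncard) else 0

lemma leafProb_nonneg (v : V) (W : Finset V) (ρ : Config V) (w : V) (k : ℕ) :
    0 ≤ leafProb G v W ρ w k := by
  unfold leafProb; split_ifs <;> positivity

lemma sum_leafProb_le (v : V) (W : Finset V) (ρ : Config V) (w : V) (s : Finset ℕ) :
    ∑ k ∈ s, leafProb G v W ρ w k ≤ 1 / 2 := by
  classical
  have hfin : (coreColors G v W ρ w).Finite := (Set.finite_Iic (G.degree w)).subset fun k hk => hk.1
  simp only [leafProb]
  rw [← Finset.sum_filter, Finset.sum_const, nsmul_eq_mul, mul_one_div]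
  have h : ((s.filter (· ∈ coreColors G v W ρ w)).card : ℝ) ≤ (coreColors G v W ρ w).ncard := by
    rw [← Set.ncard_coe_finset]
    exact_mod_cast Set.ncard_le_ncard
      (fun k hk => (Finset.mem_filter.1 (Finset.mem_coe.1 hk)).2) hfin
  rcases Nat.eq_zero_or_pos (coreColors G v W ρ w).ncard with h0 | h0
  · simp [h0]
  · have : (0 : ℝ) < (coreColors G v W ρ w).ncard := by exact_mod_cast h0
    rw [div_le_iff₀ (by positivity)]
    linarith

variable {G} {v : V} {W : Finset V} {ρ X Y : Config V}

lemma IsConfined.colorProb_eq_leafProb (hS : IsStar G v W ρ) (h : IsConfined G v W ρ X)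
    (hv : (X v).isFinal = false) {w : V} (hw : w ∈ W) (k : ℕ) :
    colorProb G X w (some k) = leafProb G v W ρ w k := by
  have hset : (palette G X w : Set ℕ) = coreColors G v W ρ w := by
    ext j
    rw [Finset.mem_coe, mem_palette, mem_tabu]
    refine and_congr_right fun _ => ?_
    push Not
    constructor
    · intro hx x hxw hxv hxW
      rw [← h.out x hxv hxW]
      exact hx x hxw (by rw [h.out x hxv hxW, hS.isFinal x hxv hxW])
    · intro hx x hxw hxf
      have hxv : x ≠ v := by rintro rfl; simp [hv] at hxf
      have hxW : x ∉ W := fun hxW => hS.indep w hw x hxW hxw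
      rw [h.out x hxv hxW]
      exact hx x hxw hxv hxW
  rw [colorProb_some, leafProb, ← hset, Set.ncard_coe_finset]
  by_cases hk : k ∈ palette G X w <;> simp [hk]

/-- The share of the centre in the potential after a round in which `v` draws the colour `c` and is
pending again, if no leaf of `P` has drawn the same colour; it is zero if `v` does not draw `c`. It
is written in terms of events whose probabilities are products. -/
def centerTerm (v : V) (P : Finset V) (c : Option ℕ) (Y : Config V) : ℝ :=
  coefA P.card * {Z : Config V | (Z v).color = c}.indicator 1 Y +
    coefS P.card * ∑ w ∈ P, {Z : Config V | (Z v).color = c ∧ (Z w).color = none}.indicator 1 Y -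
    (coefA P.card - (1 + P.card / (P.card + 1))) *
      {Z : Config V | (Z v).color = c ∧ ∀ w ∈ P, (Z w).color ≠ none}.indicator 1 Y

lemma centerTerm_of_ne {P : Finset V} {c : Option ℕ} (h : (Y v).color ≠ c) :
    centerTerm v P c Y = 0 := by
  simp [centerTerm, h]

lemma centerTerm_of_eq {P : Finset V} {c : Option ℕ} (h : (Y v).color = c) :
    centerTerm v P c Y = excess P.card {w ∈ P | (Y w).color = none}.card := by
  classical
  have h1 : ∑ w ∈ P, {Z : Config V | (Z v).color = c ∧ (Z w).color = none}.indicator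
      (1 : Config V → ℝ) Y = {w ∈ P | (Y w).color = none}.card := by
    simp [Set.indicator_apply, h]
  unfold centerTerm excess
  rw [h1]
  by_cases h0 : ∀ w ∈ P, (Y w).color ≠ none
  · have : {w ∈ P | (Y w).color = none} = ∅ := Finset.filter_eq_empty_iff.2 h0
    have h3 : Y ∈ {Z : Config V | (Z v).color = c ∧ ∀ w ∈ P, (Z w).color ≠ none} := ⟨h, h0⟩
    rw [Set.indicator_of_mem h3]
    simp [this, h]
  · have h2 : ¬ ({w ∈ P | (Y w).color = none}.card = 0) := by
      rwa [Finset.card_eq_zero, Finset.filter_eq_empty_iff]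
    rw [if_neg h2]
    simp [h, h0]

lemma centerTerm_nonneg {P : Finset V} {c : Option ℕ} : 0 ≤ centerTerm v P c Y := by
  by_cases h : (Y v).color = c
  · rw [centerTerm_of_eq h]; exact excess_nonneg _ _
  · rw [centerTerm_of_ne h]

lemma integrable_centerTerm {P : Finset V} {c : Option ℕ} :
    Integrable (centerTerm v P c) (step G X) :=
  (((integrable_indicator_step G X _).const_mul _).add ((integrable_finsetSum _ fun _ _ =>
    integrable_indicator_step G X _).const_mul _)).sub
      ((integrable_indicator_step G X _).const_mul _)

lemma integral_centerTerm {P : Finset V} (hv : newFinal G X v = false)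
    (hP : ∀ w ∈ P, newFinal G X w = false) (hvP : v ∉ P) (c : Option ℕ) :
    ∫ Y, centerTerm v P c Y ∂(step G X) = colorProb G X v c * meanExcess P.card := by
  unfold centerTerm
  rw [integral_sub, integral_add, integral_const_mul, integral_const_mul, integral_const_mul,
    integral_finsetSum _ fun _ _ => integrable_indicator_step G X _, integral_indicator_step,
    integral_indicator_step, step_real_color hv, step_real_color_ne_none hv hP hvP,
    Finset.sum_congr rfl fun w hw => by
      rw [integral_indicator_step, step_real_color₂ hv (hP w hw) (ne_of_mem_of_not_mem hw hvP).symm,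
        colorProb_none]]
  · rw [Finset.sum_const, nsmul_eq_mul, meanExcess]
    ring
  · exact (integrable_indicator_step G X _).const_mul _
  · exact (integrable_finsetSum _ fun _ _ => integrable_indicator_step G X _).const_mul _
  · exact ((integrable_indicator_step G X _).const_mul _).add
      ((integrable_finsetSum _ fun _ _ => integrable_indicator_step G X _).const_mul _)
  · exact (integrable_indicator_step G X _).const_mul _

/-- The contribution of a leaf `w ∈ P` to the potential after a round in which `v` draws the
colour `k`, and `w` draws the same colour (first two terms) or `⊥` (last term). -/
def leafTerm (v : V) (P : Finset V) (w : V) (q : ℝ) (k : ℕ) (Y : Config V) : ℝ :=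
  (1 + coefA P.card + coefS P.card) *
      {Z : Config V | (Z v).color = some k ∧ (Z w).color = some k}.indicator 1 Y +
    coefS P.card * ∑ x ∈ P, {Z : Config V | (Z v).color = some k ∧
      (Z w).color = some k ∧ (Z x).color = none}.indicator 1 Y +
    2 * q * {Z : Config V | (Z v).color = some k ∧ (Z w).color = none}.indicator 1 Y

lemma leafTerm_nonneg {P : Finset V} {w : V} {q : ℝ} {k : ℕ} (hq : 0 ≤ q) :
    0 ≤ leafTerm v P w q k Y := by
  have h1 := coefA_nonneg P.card
  have h2 := coefS_nonneg P.card
  have h3 : ∀ s : Set (Config V), 0 ≤ s.indicator (1 : Config V → ℝ) Y := fun s =>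
    Set.indicator_nonneg (by simp) _
  have h4 : 0 ≤ ∑ x ∈ P, {Z : Config V | (Z v).color = some k ∧
      (Z w).color = some k ∧ (Z x).color = none}.indicator (1 : Config V → ℝ) Y :=
    Finset.sum_nonneg fun x _ => h3 _
  have h5 := h3 {Z : Config V | (Z v).color = some k ∧ (Z w).color = some k}
  have h6 := h3 {Z : Config V | (Z v).color = some k ∧ (Z w).color = none}
  unfold leafTerm
  positivity

lemma leafTerm_of_eq {P : Finset V} {w : V} {q : ℝ} {k : ℕ} (hv : (Y v).color = some k)
    (hw : (Y w).color = some k) : leafTerm v P w q k Y =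
      1 + coefA P.card + coefS P.card * (1 + {x ∈ P | (Y x).color = none}.card) := by
  classical
  have h1 : ∑ x ∈ P, {Z : Config V | (Z v).color = some k ∧
      (Z w).color = some k ∧ (Z x).color = none}.indicator (1 : Config V → ℝ) Y =
      {x ∈ P | (Y x).color = none}.card := by
    simp [Set.indicator_apply, hv, hw]
  unfold leafTerm
  rw [h1]
  simp [hv, hw]
  ring

lemma leafTerm_of_none {P : Finset V} {w : V} {q : ℝ} {k : ℕ} (hv : (Y v).color = some k)
    (hw : (Y w).color = none) : leafTerm v P w q k Y = 2 * q := by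
  simp [leafTerm, hv, hw]

lemma integrable_leafTerm {P : Finset V} {w : V} {q : ℝ} {k : ℕ} :
    Integrable (leafTerm v P w q k) (step G X) :=
  (((integrable_indicator_step G X _).const_mul _).add ((integrable_finsetSum _ fun _ _ =>
    integrable_indicator_step G X _).const_mul _)).add
      ((integrable_indicator_step G X _).const_mul _)

lemma integral_leafTerm {P : Finset V} (hv : newFinal G X v = false)
    (hP : ∀ w ∈ P, newFinal G X w = false) (hvP : v ∉ P) {w : V} (hw : w ∈ P) (q : ℝ) (k : ℕ) :
    ∫ Y, leafTerm v P w q k Y ∂(step G X) = colorProb G X v (some k) *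
      ((1 + coefA P.card + coefS P.card * ((P.card + 1) / 2)) * colorProb G X w (some k) + q) := by
  classical
  have hvw : v ≠ w := (ne_of_mem_of_not_mem hw hvP).symm
  have hsum : ∑ x ∈ P, (step G X).real {Z : Config V | (Z v).color = some k ∧
      (Z w).color = some k ∧ (Z x).color = none} =
      (P.card - 1) * (colorProb G X v (some k) * (colorProb G X w (some k) * (1 / 2))) := by
    have h0 : (step G X).real {Z : Config V | (Z v).color = some k ∧
        (Z w).color = some k ∧ (Z w).color = none} = 0 := by
      have : {Z : Config V | (Z v).color = some k ∧
        (Z w).color = some k ∧ (Z w).color = none} = ∅ := by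
        ext Z
        simp only [Set.mem_ofPred_eq, Set.mem_empty_iff_false, iff_false]
        rintro ⟨-, h1, h2⟩
        simp [h1] at h2
      rw [this, measureReal_empty]
    rw [← Finset.sum_erase P h0, Finset.sum_congr rfl fun x hx => by
      rw [step_real_color₃ hv (hP w hw) (hP x (Finset.mem_of_mem_erase hx)) hvw
        (ne_of_mem_of_not_mem (Finset.mem_of_mem_erase hx) hvP).symm
        (Finset.ne_of_mem_erase hx).symm,
        colorProb_none], Finset.sum_const, nsmul_eq_mul, Finset.card_erase_of_mem hw,
      Nat.cast_sub (Finset.card_pos.2 ⟨w, hw⟩), Nat.cast_one]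
  unfold leafTerm
  rw [integral_add, integral_add, integral_const_mul, integral_const_mul, integral_const_mul,
    integral_finsetSum _ fun _ _ => integrable_indicator_step G X _, integral_indicator_step,
    integral_indicator_step, step_real_color₂ hv (hP w hw) hvw, step_real_color₂ hv (hP w hw) hvw,
    Finset.sum_congr rfl fun x hx => integral_indicator_step G X _, hsum, colorProb_none]
  · ring
  · exact (integrable_indicator_step G X _).const_mul _
  · exact (integrable_finsetSum _ fun _ _ => integrable_indicator_step G X _).const_mul _
  · exact ((integrable_indicator_step G X _).const_mul _).add
      ((integrable_finsetSum _ fun _ _ => integrable_indicator_step G X _).const_mul _)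
  · exact (integrable_indicator_step G X _).const_mul _

end

/-! ### The mean of the potential halves in every round -/

section

variable {V : Type*} [Fintype V] (G : SimpleGraph V) [DecidableRel G.Adj]

/-- A bound for the potential after a round in which `v` and the leaves in `P` draw new colours. The
leaves in `N` set their flags in this round, so that the palette of `v` may contain their colours.
-/
def roundMajorant (v : V) (W P N : Finset V) (ρ X Y : Config V) : ℝ :=
  ∑ w ∈ P, {Z : Config V | (Z w).color = none}.indicator 1 Y +
    (centerTerm v P none Y + ∑ u ∈ N, centerTerm v P (X u).color Y) +
    ∑ w ∈ P, ∑ k ∈ palette G X v, leafTerm v P w (leafProb G v W ρ w k) k Y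

variable {G} {v : V} {W P N : Finset V} {ρ X Y : Config V}

lemma integrable_roundMajorant : Integrable (roundMajorant G v W P N ρ X) (step G X) :=
  ((integrable_finsetSum _ fun _ _ => integrable_indicator_step G X _).add
    (integrable_centerTerm.add (integrable_finsetSum _ fun _ _ => integrable_centerTerm))).add
    (integrable_finsetSum _ fun _ _ => integrable_finsetSum _ fun _ _ => integrable_leafTerm)

lemma integral_roundMajorant_le (hv : newFinal G X v = false)
    (hP : ∀ w ∈ P, newFinal G X w = false) (hvP : v ∉ P) (hN : ∀ u ∈ N, (X u).color ≠ none)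
    {a : ℕ} (ha : N.card ≤ a) :
    ∫ Y, roundMajorant G v W P N ρ X Y ∂(step G X) ≤
      1 / 2 * (P.card + roundBound P.card a (palette G X v).card) := by
  have hK : (0 : ℝ) < (palette G X v).card := by
    exact_mod_cast (palette_nonempty G X v).card_pos
  have hA := coefA_nonneg P.card
  have hS := coefS_nonneg P.card
  have hE := meanExcess_nonneg P.card
  unfold roundMajorant
  rw [integral_add, integral_add, integral_add, integral_finsetSum, integral_finsetSum,
    integral_finsetSum, integral_centerTerm hv hP hvP, colorProb_none]
  · rw [Finset.sum_congr rfl fun w hw => (integral_indicator_step G X _).trans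
      ((step_real_color (hP w hw) _).trans (colorProb_none G X w)), Finset.sum_const,
      Finset.sum_congr rfl fun u _ => integral_centerTerm hv hP hvP _,
      Finset.sum_congr rfl fun w hw => (integral_finsetSum _ fun _ _ => integrable_leafTerm).trans
        (Finset.sum_congr rfl fun k _ => integral_leafTerm hv hP hvP hw _ k)]
    have h1 : ∑ u ∈ N, colorProb G X v (X u).color * meanExcess P.card ≤
        a * (1 / (2 * (palette G X v).card) * meanExcess P.card) := by
      refine (Finset.sum_le_card_nsmul _ _ (1 / (2 * (palette G X v).card) * meanExcess P.card)
        fun u hu => ?_).trans ?_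
      · obtain ⟨k, hk⟩ := Option.ne_none_iff_exists'.1 (hN u hu)
        rw [hk]
        exact mul_le_mul_of_nonneg_right (colorProb_some_le k) hE
      · rw [nsmul_eq_mul]
        gcongr
    have h2 : ∀ w ∈ P, ∑ k ∈ palette G X v, colorProb G X v (some k) *
        ((1 + coefA P.card + coefS P.card * ((P.card + 1) / 2)) * colorProb G X w (some k) +
          leafProb G v W ρ w k) ≤ 1 / (2 * (palette G X v).card) *
        ((1 + coefA P.card + coefS P.card * ((P.card + 1) / 2)) * (1 / 2) + 1 / 2) := by
      intro w _
      calc _ ≤ ∑ k ∈ palette G X v, 1 / (2 * ((palette G X v).card : ℝ)) *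
            ((1 + coefA P.card + coefS P.card * ((P.card + 1) / 2)) * colorProb G X w (some k) +
              leafProb G v W ρ w k) := by
            refine Finset.sum_le_sum fun k _ =>
              mul_le_mul_of_nonneg_right (colorProb_some_le k) ?_
            have := colorProb_nonneg G X w (some k)
            have := leafProb_nonneg G v W ρ w k
            positivity
        _ ≤ _ := by
            rw [← Finset.mul_sum, Finset.sum_add_distrib, ← Finset.mul_sum]
            have := sum_colorProb_le (G := G) (X := X) (u := w) (palette G X v)
            have := sum_leafProb_le G v W ρ w (palette G X v)
            gcongr
    have h3 := Finset.sum_le_card_nsmul _ _ _ h2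
    rw [nsmul_eq_mul] at h3
    refine (add_le_add (add_le_add_right (add_le_add_right h1 _) _) h3).trans_eq ?_
    unfold roundBound
    rw [nsmul_eq_mul]
    field_simp
    ring
  · exact fun _ _ => integrable_finsetSum _ fun _ _ => integrable_leafTerm
  · exact fun _ _ => integrable_centerTerm
  · exact fun _ _ => integrable_indicator_step G X _
  · exact integrable_centerTerm
  · exact integrable_finsetSum _ fun _ _ => integrable_centerTerm
  · exact integrable_finsetSum _ fun _ _ => integrable_indicator_step G X _
  · exact integrable_centerTerm.add (integrable_finsetSum _ fun _ _ => integrable_centerTerm)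
  · exact (integrable_finsetSum _ fun _ _ => integrable_indicator_step G X _).add
      (integrable_centerTerm.add (integrable_finsetSum _ fun _ _ => integrable_centerTerm))
  · exact integrable_finsetSum _ fun _ _ => integrable_finsetSum _ fun _ _ => integrable_leafTerm

/-- If `v` keeps the drawn colour, then the pending leaves are those that drew `⊥`, and each of them
counts for its `leafTerm`. If `v` has drawn the colour of a pending leaf, then the sum of the
`leafTerm`s is large enough. In the other cases, `v` has drawn `⊥` or the colour of a leaf in `N`,
and a `centerTerm` is its share. -/
lemma IsPrepared.potential_le_roundMajorant (hS : IsStar G v W ρ) (h : IsPrepared G v W ρ X)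
    (hv : newFinal G X v = false) (hY : IsSuccessor G X Y) :
    potential G v W Y ≤ roundMajorant G v W (pendingLeaves G W X)
      {u ∈ W | newFinal G X u = true ∧ (X u).isFinal = false} ρ X Y := by
  classical
  set P := pendingLeaves G W X with hPdef
  set N : Finset V := {u ∈ W | newFinal G X u = true ∧ (X u).isFinal = false} with hNdef
  have hconf := h.isConfined_of_isSuccessor hS hY
  have hYf : (Y v).isFinal = false := ((hY v).2 hv).1
  set B : Finset V := {w ∈ P | (Y w).color = none} with hBdef
  -- bounds from below for the parts of `roundMajorant`
  have hT1 : ∑ w ∈ P, {Z : Config V | (Z w).color = none}.indicator (1 : Config V → ℝ) Y =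
      B.card := by simp [Set.indicator_apply, hBdef]
  have hT4 : ∀ c ∈ insert none (N.image fun u => (X u).color), (Y v).color = c →
      excess P.card B.card ≤ centerTerm v P none Y + ∑ u ∈ N, centerTerm v P (X u).color Y := by
    intro c hc hcY
    rw [← centerTerm_of_eq hcY]
    rcases Finset.mem_insert.1 hc with rfl | hc
    · exact le_add_of_nonneg_right (Finset.sum_nonneg fun _ _ => centerTerm_nonneg)
    · obtain ⟨u, hu, rfl⟩ := Finset.mem_image.1 hc
      exact (Finset.single_le_sum (f := fun u => centerTerm v P (X u).color Y)
        (fun _ _ => centerTerm_nonneg) hu).trans (le_add_of_nonneg_left centerTerm_nonneg)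
  have hT4' : 0 ≤ centerTerm v P none Y + ∑ u ∈ N, centerTerm v P (X u).color Y :=
    add_nonneg centerTerm_nonneg (Finset.sum_nonneg fun _ _ => centerTerm_nonneg)
  have hq : ∀ w k, 0 ≤ leafProb G v W ρ w k := leafProb_nonneg G v W ρ
  have hT5' : 0 ≤ ∑ w ∈ P, ∑ k ∈ palette G X v, leafTerm v P w (leafProb G v W ρ w k) k Y :=
    Finset.sum_nonneg fun w _ => Finset.sum_nonneg fun k _ => leafTerm_nonneg (hq w k)
  have hT5 : ∀ Q ⊆ P, ∀ k, (Y v).color = some k →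
      ∑ w ∈ Q, leafTerm v P w (leafProb G v W ρ w k) k Y ≤
      ∑ w ∈ P, ∑ k ∈ palette G X v, leafTerm v P w (leafProb G v W ρ w k) k Y := by
    intro Q hQ k hk
    refine (Finset.sum_le_sum fun w _ => ?_).trans (Finset.sum_le_sum_of_subset_of_nonneg hQ
      fun w _ _ => Finset.sum_nonneg fun k _ => leafTerm_nonneg (hq w k))
    exact Finset.single_le_sum (f := fun k => leafTerm v P w (leafProb G v W ρ w k) k Y)
      (fun k _ => leafTerm_nonneg (hq w k)) (((hY v).2 hv).2 k hk)
  have hPY : ∀ w, w ∈ pendingLeaves G W Y ↔ w ∈ P ∧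
      ((Y w).color = none ∨ (Y w).color = (Y v).color) := fun w => h.mem_pendingLeaves_iff hS hY
  have hPY' : (¬ ∃ w ∈ P, (Y w).color ≠ none ∧ (Y w).color = (Y v).color) →
      pendingLeaves G W Y = B := by
    intro hne
    ext w
    rw [hPY, hBdef, Finset.mem_filter]
    refine and_congr_right fun hw => ⟨fun ho => ?_, .inl⟩
    by_contra hn
    exact hne ⟨w, hw, hn, ho.resolve_left hn⟩
  have hM : {w ∈ W | (Y w).isFinal = false} = P := by
    ext w
    rw [Finset.mem_filter, hPdef, mem_pendingLeaves]
    refine and_congr_right fun _ => ?_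
    cases hn : newFinal G X w
    · simp [((hY w).2 hn).1]
    · simp [(hY w).1 hn]
  unfold roundMajorant potential
  rw [hT1, hM]
  split_ifs with hYv
  · obtain ⟨hc, hor⟩ := (hconf.newFinal_center hS).1 hYv
    have hdiff : ∀ w ∈ W, (Y w).color ≠ (Y v).color := hor.resolve_left (by simp [hYf])
    have hPB := hPY' fun ⟨w, hw, _, he⟩ => hdiff w (mem_pendingLeaves.1 hw).1 he
    obtain ⟨k, hk⟩ := Option.ne_none_iff_exists'.1 hc
    have h5 := hT5 B (Finset.filter_subset _ _) k hk
    have h6 : ∑ w ∈ B, leafTerm v P w (leafProb G v W ρ w k) k Y =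
        ∑ w ∈ B, 2 * colorProb G Y w (Y v).color := by
      refine Finset.sum_congr rfl fun w hw => ?_
      obtain ⟨hwP, hw0⟩ := Finset.mem_filter.1 hw
      rw [leafTerm_of_none hk hw0, hk,
        hconf.colorProb_eq_leafProb hS hYf (mem_pendingLeaves.1 hwP).1]
    rw [hPB, Finset.sum_add_distrib, Finset.sum_const, nsmul_eq_mul, mul_one, ← h6]
    linarith
  · by_cases hcoin : ∃ w ∈ P, (Y w).color ≠ none ∧ (Y w).color = (Y v).color
    · set C : Finset V := {w ∈ P | (Y w).color = (Y v).color} with hCdef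
      obtain ⟨w₀, hw₀, hn₀, he₀⟩ := hcoin
      obtain ⟨k, hk⟩ := Option.ne_none_iff_exists'.1 (he₀ ▸ hn₀)
      have h5 := hT5 C (Finset.filter_subset _ _) k hk
      have h6 : ∑ w ∈ C, leafTerm v P w (leafProb G v W ρ w k) k Y =
          C.card * (1 + coefA P.card + coefS P.card * (1 + B.card)) := by
        rw [← nsmul_eq_mul, ← Finset.sum_const]
        refine Finset.sum_congr rfl fun w hw => ?_
        exact leafTerm_of_eq hk ((Finset.mem_filter.1 hw).2.trans hk)
      have hcard : (pendingLeaves G W Y).card = B.card + C.card := by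
        rw [← Finset.card_union_of_disjoint]
        · congr 1
          ext w
          rw [hPY, Finset.mem_union, hBdef, hCdef, Finset.mem_filter, Finset.mem_filter,
            and_or_left]
        · rw [Finset.disjoint_left]
          intro w hB hC
          have h1 := (Finset.mem_filter.1 hB).2
          rw [(Finset.mem_filter.1 hC).2, hk] at h1
          simp at h1
      have hC1 : 1 ≤ C.card := Finset.card_pos.2 ⟨w₀, Finset.mem_filter.2 ⟨hw₀, he₀⟩⟩
      have hC1' : (1 : ℝ) ≤ C.card := by exact_mod_cast hC1
      rw [hcard, excess, if_neg (by omega)]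
      have hA := coefA_nonneg P.card
      have hSS := coefS_nonneg P.card
      have hB0 : (0 : ℝ) ≤ B.card := Nat.cast_nonneg _
      push_cast
      nlinarith [mul_nonneg (sub_nonneg.2 hC1') hA,
        mul_nonneg (mul_nonneg (sub_nonneg.2 hC1') hSS) hB0]
    · rw [hPY' hcoin]
      have hcN : (Y v).color ∈ insert none (N.image fun u => (X u).color) := by
        by_cases hc : (Y v).color = none
        · simp [hc]
        · refine Finset.mem_insert_of_mem ?_
          rw [hconf.newFinal_center hS] at hYv
          push Not at hYv
          obtain ⟨-, u, hu, he⟩ := hYv hc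
          have hun : newFinal G X u = true := by
            by_contra hun
            rw [Bool.not_eq_true] at hun
            exact hcoin ⟨u, mem_pendingLeaves.2 ⟨hu, hun⟩, he ▸ hc, he⟩
          have huc : (Y u).color = (X u).color := by rw [(hY u).1 hun]
          refine Finset.mem_image.2 ⟨u, Finset.mem_filter.2 ⟨hu, hun, ?_⟩, huc ▸ he⟩
          -- `v` avoids the colours of the leaves whose flag was set before the round
          by_contra huf
          rw [Bool.not_eq_false] at huf
          obtain ⟨k, hk⟩ := Option.ne_none_iff_exists'.1 hc
          exact ((mem_palette G).1 (((hY v).2 hv).2 k hk)).2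
            ((mem_tabu G).2 ⟨u, hS.adj u hu, huf, by rw [← huc, he, hk]⟩)
      have h4 := hT4 _ hcN rfl
      linarith

/-- The mean of the potential after a round in which `v` draws a new colour. -/
lemma IsPrepared.lintegral_potential_le_of_not_newFinal (hS : IsStar G v W ρ)
    (h : IsPrepared G v W ρ X) (hv : newFinal G X v = false) {a : ℕ}
    (ha : {u ∈ W | newFinal G X u = true ∧ (X u).isFinal = false}.card ≤ a) :
    ∫⁻ Y, ENNReal.ofReal (potential G v W Y) ∂(step G X) ≤
      ENNReal.ofReal (1 / 2 * ((pendingLeaves G W X).card +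
        roundBound (pendingLeaves G W X).card a (palette G X v).card)) := by
  refine lintegral_step_ofReal_le (potential_nonneg G v W) (integrable_roundMajorant)
    ((ae_isSuccessor G X).mono fun Y hY => h.potential_le_roundMajorant hS hv hY)
    (integral_roundMajorant_le hv (fun w hw => (mem_pendingLeaves.1 hw).2)
      (fun hvP => (hS.adj v (mem_pendingLeaves.1 hvP).1).ne rfl) (fun u hu => ?_) ha)
  obtain ⟨k, hk, -⟩ := (newFinal_eq_true_iff G).1 (Finset.mem_filter.1 hu).2.1
  simp [hk]

/-- In a confined configuration, the mean of the potential halves in every round. -/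
lemma IsConfined.lintegral_potential_le (hS : IsStar G v W ρ) (h : IsConfined G v W ρ X) :
    ∫⁻ Y, ENNReal.ofReal (potential G v W Y) ∂(step G X) ≤
      ENNReal.ofReal (1 / 2 * potential G v W X) := by
  classical
  have hp := h.isPrepared hS
  cases hv : newFinal G X v with
  | true => exact hp.lintegral_potential_le_of_newFinal hS hv
  | false =>
    set N : Finset V := {u ∈ W | newFinal G X u = true ∧ (X u).isFinal = false} with hN
    have hM : {w ∈ W | (X w).isFinal = false}.card = (pendingLeaves G W X).card + N.card := by
      rw [← Finset.card_union_of_disjoint]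
      · congr 1
        ext w
        rw [Finset.mem_union, hN, Finset.mem_filter, Finset.mem_filter, mem_pendingLeaves,
          ← and_or_left]
        refine and_congr_right fun hw => ?_
        cases hn : newFinal G X w
        · rw [← Bool.not_eq_true, h.newFinal_leaf hS hw] at hn
          have : (X w).isFinal ≠ true := fun hf => hn ⟨h.ne_none w (.inr hw) hf, .inl hf⟩
          simpa using this
        · simp
      · rw [Finset.disjoint_left]
        intro w h1 h2
        have := (mem_pendingLeaves.1 h1).2
        simp [(Finset.mem_filter.1 h2).2.1] at this
    have hK := card_lt_card_palette G hS.adj X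
    rw [hM] at hK
    refine (hp.lintegral_potential_le_of_not_newFinal hS hv (a := N.card) le_rfl).trans
      (ENNReal.ofReal_le_ofReal ?_)
    rw [potential, if_neg (by simp [hv]), hM]
    have h1 := roundBound_anti (m := (pendingLeaves G W X).card) (a := N.card)
      (K := (pendingLeaves G W X).card + N.card + 1) (K' := (palette G X v).card) (by positivity)
      (by exact_mod_cast hK)
    have h2 := roundBound_le_excess (pendingLeaves G W X).card N.card
    linarith

end

/-! ### Tail bounds and the containment time -/

section

variable {V : Type*} [Fintype V] {G : SimpleGraph V} [DecidableRel G.Adj]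

variable {v : V} {W : Finset V} {ρ σ X Y : Config V}

lemma IsPrepared.legitimate_of_isSuccessor (hS : IsStar G v W ρ) (h : IsPrepared G v W ρ X)
    (hn : ∀ u, (u = v ∨ u ∈ W) → newFinal G X u = true) (hY : IsSuccessor G X Y) :
    Legitimate G Y :=
  (h.isConfined_of_isSuccessor hS hY).legitimate hS fun u hu => by rw [(hY u).1 (hn u hu)]

lemma Legitimate.newFinal (hX : Legitimate G X) (u : V) : newFinal G X u = true := by
  obtain ⟨hf, k, hk, hd⟩ := hX.1 u
  refine (newFinal_eq_true_iff G).2 ⟨k, hk, hd, .inl ⟨hf, fun ht => ?_⟩⟩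
  obtain ⟨w, hw, -, hwk⟩ := (mem_tabu G).1 ht
  exact hX.2 u w hw (hk.trans hwk.symm)

lemma Legitimate.eq_of_isSuccessor (hX : Legitimate G X) (hY : IsSuccessor G X Y) : Y = X := by
  funext u
  rw [(hY u).1 (hX.newFinal u)]
  exact NodeState.ext rfl (hX.1 u).1.symm

/-- The potential controls the probability that a confined configuration does not recover. -/
lemma IsConfined.stepExp_iterate_le (hS : IsStar G v W ρ) (h : IsConfined G v W ρ X) (t : ℕ) :
    (stepExp G)^[t + 1] ({Y | ¬ Legitimate G Y}.indicator 1) X ≤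
      ENNReal.ofReal ((1 / 2) ^ t * potential G v W X) := by
  induction t generalizing X with
  | zero =>
    rw [zero_add, Function.iterate_one, pow_zero, one_mul, stepExp,
      lintegral_indicator_one (Set.to_countable _).measurableSet]
    by_cases hn : ∀ u, (u = v ∨ u ∈ W) → newFinal G X u = true
    · refine le_of_eq_of_le ?_ zero_le
      refine measure_eq_zero_iff_ae_notMem.2 ((ae_isSuccessor G X).mono fun Y hY => ?_)
      exact not_not.2 ((h.isPrepared hS).legitimate_of_isSuccessor hS hn hY)
    · refine prob_le_one.trans (ENNReal.one_le_ofReal.2 ?_)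
      unfold potential
      split_ifs with hv
      · push Not at hn
        obtain ⟨u, hu, hun⟩ := hn
        have huW : u ∈ W := hu.resolve_left fun h => hun (h ▸ hv)
        have hle := Finset.single_le_sum
          (f := fun w => 1 + 2 * colorProb G X w (X v).color)
          (fun w _ => by linarith [colorProb_nonneg G X w (X v).color])
          (mem_pendingLeaves.2 ⟨huW, by simpa using hun⟩ : u ∈ pendingLeaves G W X)
        have := colorProb_nonneg G X u (X v).color
        linarith
      · exact one_le_card_add_excess _ _
  | succ t ih =>
    rw [Function.iterate_succ_apply', stepExp]
    calc ∫⁻ Y, (stepExp G)^[t + 1] ({Y | ¬ Legitimate G Y}.indicator 1) Y ∂(step G X)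
        ≤ ∫⁻ Y, ENNReal.ofReal ((1 / 2) ^ t) * ENNReal.ofReal (potential G v W Y) ∂(step G X) := by
          refine lintegral_mono_ae ((ae_isSuccessor G X).mono fun Y hY => ?_)
          rw [← ENNReal.ofReal_mul (by positivity)]
          exact ih ((h.isPrepared hS).isConfined_of_isSuccessor hS hY)
      _ ≤ ENNReal.ofReal ((1 / 2) ^ t) * ENNReal.ofReal (1 / 2 * potential G v W X) := by
          rw [lintegral_const_mul _ (measurable_of_countable _)]
          gcongr
          exact h.lintegral_potential_le hS
      _ = _ := by
          rw [← ENNReal.ofReal_mul (by positivity)]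
          congr 1
          ring

lemma one_le_initBound (n : ℕ) : 1 ≤ initBound n := by
  unfold initBound
  split_ifs
  · exact le_rfl
  · linarith [(Nat.cast_nonneg n : (0 : ℝ) ≤ n)]

/-- After a corruption that forces `v` to draw a new colour, the containment time has an exponential
tail. Here `W` is the set of those neighbours of `v` whose colour collides with the corrupted one.
-/
lemma MemoryCorruption.stepExp_iterate_le (hρ : Legitimate G ρ) (hσ : MemoryCorruption ρ σ v)
    (hv : newFinal G σ v = false)
    (hW : ∀ w, w ∈ W ↔ G.Adj v w ∧ (σ v).isFinal = true ∧ (σ w).color = (σ v).color) (t : ℕ) :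
    (stepExp G)^[t + 1] ({Y | ¬ Legitimate G Y}.indicator 1) σ ≤
      ENNReal.ofReal ((1 / 2) ^ t * initBound W.card) := by
  have hadj : ∀ w ∈ W, G.Adj v w := fun w hw => ((hW w).1 hw).1
  have hcol : ∀ w ∈ W, (σ w).color = (σ v).color := fun w hw => ((hW w).1 hw).2.2
  have hS : IsStar G v W ρ := hρ.isStar hadj (σ v).color fun w hw => by
    rw [← hσ.2 w (hadj w hw).ne', hcol w hw]
  have hp : IsPrepared G v W ρ σ := hσ.isPrepared_of_not_newFinal hρ hv hW
  have hpend : ∀ w ∈ W, newFinal G σ w = false := fun w hw =>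
    hσ.newFinal_eq_false hρ (hadj w hw) ((hW w).1 hw).2.1 (hcol w hw)
  have hPW : pendingLeaves G W σ = W := Finset.filter_true_of_mem hpend
  have hcard : (W.card : ℝ) ≤ (palette G σ v).card := by
    rcases W.eq_empty_or_nonempty with rfl | hne
    · simp
    · exact_mod_cast card_le_card_palette G hadj σ _ hcol hne
  cases t with
  | zero =>
    rw [zero_add, Function.iterate_one, pow_zero, one_mul, stepExp,
      lintegral_indicator_one (Set.to_countable _).measurableSet]
    exact prob_le_one.trans (ENNReal.one_le_ofReal.2 (one_le_initBound _))
  | succ t =>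
    have h0 := hp.lintegral_potential_le_of_not_newFinal hS hv (a := 0) (le_of_eq
      (Finset.card_eq_zero.2 (Finset.filter_eq_empty_iff.2 fun w hw => by simp [hpend w hw])))
    rw [hPW] at h0
    rw [Function.iterate_succ_apply', stepExp]
    calc ∫⁻ Y, (stepExp G)^[t + 1] ({Y | ¬ Legitimate G Y}.indicator 1) Y ∂(step G σ)
        ≤ ∫⁻ Y, ENNReal.ofReal ((1 / 2) ^ t) * ENNReal.ofReal (potential G v W Y) ∂(step G σ) := by
          refine lintegral_mono_ae ((ae_isSuccessor G σ).mono fun Y hY => ?_)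
          rw [← ENNReal.ofReal_mul (by positivity)]
          exact (hp.isConfined_of_isSuccessor hS hY).stepExp_iterate_le hS t
      _ ≤ ENNReal.ofReal ((1 / 2) ^ t) * ENNReal.ofReal (1 / 2 * initBound W.card) := by
          rw [lintegral_const_mul _ (measurable_of_countable _)]
          gcongr
          refine h0.trans (ENNReal.ofReal_le_ofReal ?_)
          have := roundBound_le_initBound hcard
          linarith
      _ = _ := by
          rw [← ENNReal.ofReal_mul (by positivity)]
          congr 1
          ring

lemma MemoryCorruption.ae_legitimate_step (hρ : Legitimate G ρ) (hσ : MemoryCorruption ρ σ v)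
    (hv : newFinal G σ v = true) : ∀ᵐ Y ∂(step G σ), Legitimate G Y :=
  (ae_isSuccessor G σ).mono fun _ hY => (hσ.isPrepared_of_newFinal hρ hv).legitimate_of_isSuccessor
    (hρ.isStar (by simp) none (by simp)) (fun u hu => by
      obtain rfl : u = v := by simpa using hu
      exact hv) hY

variable (G)

lemma ae_legitimate_succ (σ : Config V) :
    ∀ᵐ ω ∂(execution G σ), ∀ t, Legitimate G (ω t) → Legitimate G (ω (t + 1)) :=
  ae_execution_step G σ (fun X Y => Legitimate G X → Legitimate G Y) fun X =>
    (ae_isSuccessor G X).mono fun _ hY hX => (hX.eq_of_isSuccessor hY).symm ▸ hX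

lemma measurableSet_legitimate (t : ℕ) : MeasurableSet {ω : ℕ → Config V | Legitimate G (ω t)} :=
  (Set.to_countable {Y | Legitimate G Y}).measurableSet.preimage
    (measurable_pi_apply (X := fun _ : ℕ => Config V) t)

lemma recoveryTime_le_iff {ω : ℕ → Config V} (h : ∃ n, Legitimate G (ω n))
    (hs : ∀ t, Legitimate G (ω t) → Legitimate G (ω (t + 1))) (t : ℕ) :
    recoveryTime G ω ≤ t ↔ Legitimate G (ω t) := by
  constructor
  · intro ht
    exact Nat.le_induction (Nat.sInf_mem h : Legitimate G (ω (recoveryTime G ω)))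
      (fun n _ => hs n) t ht
  · exact fun ht => Nat.sInf_le ht

lemma measurable_recoveryTime : Measurable (recoveryTime G : (ℕ → Config V) → ℕ) := by
  refine measurable_of_Iic fun t => ?_
  have : recoveryTime G ⁻¹' Set.Iic t =
      (⋃ k ∈ Set.Iic t, {ω : ℕ → Config V | Legitimate G (ω k)}) ∪
        (⋃ k, {ω : ℕ → Config V | Legitimate G (ω k)})ᶜ := by
    ext ω
    simp only [Set.mem_preimage, Set.mem_Iic, Set.mem_union, Set.mem_iUnion, Set.mem_ofPred_eq,
      Set.mem_compl_iff, exists_prop]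
    constructor
    · intro ht
      by_cases h : ∃ k, Legitimate G (ω k)
      · exact .inl ⟨_, ht, Nat.sInf_mem h⟩
      · exact .inr h
    · rintro (⟨k, hk, hL⟩ | h)
      · exact (Nat.sInf_le hL).trans hk
      · push Not at h
        have : {n | Legitimate G (ω n)} = ∅ := Set.eq_empty_of_forall_notMem h
        simp [recoveryTime, this]
  rw [this]
  exact (MeasurableSet.biUnion (Set.to_countable _) fun k _ => measurableSet_legitimate G k).union
    (MeasurableSet.iUnion fun k => measurableSet_legitimate G k).compl

variable {G}

lemma ae_exists_legitimate {ψ : ℝ}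
    (h : ∀ t, (stepExp G)^[t + 1] ({Y | ¬ Legitimate G Y}.indicator 1) σ ≤
      ENNReal.ofReal ((1 / 2) ^ t * ψ)) :
    ∀ᵐ ω ∂(execution G σ), ∃ n, Legitimate G (ω n) := by
  rw [ae_iff]
  refine le_antisymm (ge_of_tendsto (f := fun t : ℕ => ENNReal.ofReal ((1 / 2) ^ t * ψ))
    (x := Filter.atTop) ?_ (.of_forall fun t => ?_)) zero_le
  · have h1 : Filter.Tendsto (fun t : ℕ => (1 / 2 : ℝ) ^ t * ψ) Filter.atTop (nhds (0 * ψ)) :=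
      (tendsto_pow_atTop_nhds_zero_of_lt_one (by norm_num) (by norm_num)).mul_const ψ
    rw [zero_mul] at h1
    simpa using ENNReal.tendsto_ofReal h1
  · refine le_trans ?_ (h t)
    rw [← execution_mem]
    refine measure_mono fun ω hω => ?_
    simp only [Set.mem_ofPred_eq, not_exists] at hω ⊢
    exact hω (t + 1)

lemma execution_lt_recoveryTime (h : ∀ᵐ ω ∂(execution G σ), ∃ n, Legitimate G (ω n)) (t : ℕ) :
    execution G σ {ω | t < recoveryTime G ω} =
      (stepExp G)^[t] ({Y | ¬ Legitimate G Y}.indicator 1) σ := by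
  rw [← execution_mem]
  refine measure_congr ?_
  filter_upwards [h, ae_legitimate_succ G σ] with ω h1 h2
  exact propext (by
    change t < recoveryTime G ω ↔ ¬ Legitimate G (ω t)
    rw [← recoveryTime_le_iff G h1 h2, not_le])

lemma execution_recoveryTime_le (h : ∀ᵐ ω ∂(execution G σ), ∃ n, Legitimate G (ω n)) (t : ℕ) :
    execution G σ {ω | recoveryTime G ω ≤ t} =
      (stepExp G)^[t] ({Y | Legitimate G Y}.indicator 1) σ := by
  rw [← execution_mem]
  refine measure_congr ?_
  filter_upwards [h, ae_legitimate_succ G σ] with ω h1 h2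
  exact propext (recoveryTime_le_iff G h1 h2 t)

end

/-! ### Moments of a random time with given tails -/

section

variable {Ω : Type*} [MeasurableSpace Ω] {μ : Measure Ω} [IsProbabilityMeasure μ] {Z : Ω → ℕ}

lemma lintegral_tsum_tail_le (hZ : Measurable Z) {ψ : ℝ} (hψ : 0 ≤ ψ)
    (hU : ∀ t, μ {ω | t < Z ω} ≤ ENNReal.ofReal ((1 / 2) ^ t * ψ)) {c : ℕ → ℝ} (hc : ∀ t, 0 ≤ c t)
    {s : ℝ} (hs : HasSum (fun t => c t * (1 / 2) ^ t) s) (k : ℕ) :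
    ∫⁻ ω, ∑' t, ENNReal.ofReal (c t) * {ω | k + t < Z ω}.indicator 1 ω ∂μ ≤
      ENNReal.ofReal (s * ((1 / 2) ^ k * ψ)) := by
  have hm : ∀ t, MeasurableSet {ω | k + t < Z ω} := fun t => hZ measurableSet_Ioi
  rw [lintegral_tsum fun t => (measurable_one.indicator (hm t)).aemeasurable.const_mul _]
  calc ∑' t, ∫⁻ ω, ENNReal.ofReal (c t) * {ω | k + t < Z ω}.indicator 1 ω ∂μ
      ≤ ∑' t, ENNReal.ofReal (c t * (1 / 2) ^ t * ((1 / 2) ^ k * ψ)) := by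
        refine ENNReal.tsum_le_tsum fun t => ?_
        rw [lintegral_const_mul _ (measurable_one.indicator (hm t)), lintegral_indicator_one (hm t),
          mul_assoc, ENNReal.ofReal_mul (hc t)]
        gcongr
        refine (hU (k + t)).trans_eq ?_
        rw [pow_add]
        congr 1
        ring
    _ = ENNReal.ofReal (s * ((1 / 2) ^ k * ψ)) := by
        have h := hs.mul_right ((1 / 2) ^ k * ψ)
        rw [← h.tsum_eq, ENNReal.ofReal_tsum_of_nonneg _ h.summable]
        intro t
        have := hc t
        positivity

lemma lintegral_le_of_tail (hZ : Measurable Z) {ψ : ℝ} (hψ : 0 ≤ ψ)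
    (hU : ∀ t, μ {ω | t < Z ω} ≤ ENNReal.ofReal ((1 / 2) ^ t * ψ)) (k : ℕ) :
    ∫⁻ ω, ENNReal.ofReal (Z ω) ∂μ ≤ ENNReal.ofReal (k + 2 * ((1 / 2) ^ k * ψ)) := by
  have h := lintegral_tsum_tail_le hZ hψ hU (c := fun _ => 1) (fun _ => zero_le_one) (s := 2)
    (by simpa using hasSum_geometric_two) k
  calc ∫⁻ ω, ENNReal.ofReal (Z ω) ∂μ ≤ ∫⁻ ω, ENNReal.ofReal k +
        ∑' t, ENNReal.ofReal ((fun _ => 1 : ℕ → ℝ) t) * {ω | k + t < Z ω}.indicator 1 ω ∂μ := by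
        refine lintegral_mono fun ω => ?_
        have h1 : (Z ω : ℝ≥0∞) ≤ k + ((Z ω - k : ℕ) : ℝ≥0∞) := by
          norm_cast; omega
        have h2 : ((Z ω - k : ℕ) : ℝ≥0∞) = ∑ t ∈ Finset.range (Z ω - k),
            ENNReal.ofReal ((fun _ => 1 : ℕ → ℝ) t) * {ω | k + t < Z ω}.indicator 1 ω := by
          rw [Finset.sum_congr rfl (g := fun _ => 1), Finset.sum_const, Finset.card_range,
            nsmul_eq_mul, mul_one]
          intro t ht
          have : k + t < Z ω := by have := Finset.mem_range.1 ht; omega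
          simp [this]
        simp only [ENNReal.ofReal_natCast]
        refine h1.trans ?_
        rw [h2]
        gcongr
        exact ENNReal.sum_le_tsum _
    _ ≤ _ := by
        rw [lintegral_add_left measurable_const, lintegral_const, measure_univ, mul_one,
          ENNReal.ofReal_add (Nat.cast_nonneg k) (by positivity)]
        gcongr

lemma hasSum_odd_mul_geometric (e : ℝ) :
    HasSum (fun t : ℕ => (2 * (t : ℝ) + 1 - 2 * e) * (1 / 2) ^ t) (6 - 4 * e) := by
  have h1 := hasSum_coe_mul_geometric_of_norm_lt_one (𝕜 := ℝ) (r := 1 / 2) (by norm_num)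
  have h2 := (h1.mul_left 2).add (hasSum_geometric_two.mul_left (1 - 2 * e))
  have h3 : (fun t : ℕ => (2 * (t : ℝ) + 1 - 2 * e) * (1 / 2) ^ t) =
      fun t : ℕ => 2 * ((t : ℝ) * (1 / 2) ^ t) + (1 - 2 * e) * (1 / 2) ^ t := by
    funext t; ring
  have h4 : 6 - 4 * e = 2 * (1 / 2 / (1 - 1 / 2) ^ 2) + (1 - 2 * e) * 2 := by
    norm_num [sub_mul]; ring
  rw [h3, h4]
  exact h2

/-- The bound for the second moment of `Z - k - e` that follows from `P(Z > t) ≤ 2⁻ᵗ ψ` and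
`P(Z ≤ t) ≤ (1 - 2⁻ᵗ) ^ N`. -/
def momentBound (N : ℕ) (ψ : ℝ) (k : ℕ) (e : ℝ) : ℝ :=
  e ^ 2 + ∑ t ∈ Finset.range k, (2 * ((k : ℝ) - t) - 1 + 2 * e) * (1 - (1 / 2) ^ t) ^ N +
    (6 - 4 * e) * ((1 / 2) ^ k * ψ)

lemma momentBound_nonneg {N : ℕ} {ψ : ℝ} (hψ : 0 ≤ ψ) (k : ℕ) {e : ℝ} (he0 : 0 ≤ e)
    (he : e ≤ 1 / 2) : 0 ≤ momentBound N ψ k e := by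
  have h : 0 ≤ 6 - 4 * e := by linarith
  refine add_nonneg (add_nonneg (sq_nonneg e) (Finset.sum_nonneg fun t ht => ?_)) (by positivity)
  have : (t : ℝ) + 1 ≤ k := by exact_mod_cast Finset.mem_range.1 ht
  exact mul_nonneg (by linarith)
    (pow_nonneg (sub_nonneg.2 (pow_le_one₀ (by norm_num) (by norm_num))) N)

lemma sum_range_odd (d : ℕ) (e : ℝ) :
    ∑ t ∈ Finset.range d, (2 * (t : ℝ) + 1 - 2 * e) = d ^ 2 - 2 * e * d := by
  induction d with
  | zero => simp
  | succ d ih => rw [Finset.sum_range_succ, ih]; push_cast; ring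

lemma sum_Ico_odd {z k : ℕ} (h : z ≤ k) (e : ℝ) :
    ∑ t ∈ Finset.Ico z k, (2 * ((k : ℝ) - t) - 1 + 2 * e) = (k - z) ^ 2 + 2 * e * (k - z) := by
  induction h using Nat.decreasingInduction with
  | self => simp
  | of_succ z hz ih => rw [Finset.sum_eq_sum_Ico_succ_bot hz, ih]; push_cast; ring

/-- The square of `Z - k - e` is `e ^ 2` plus the sum of `2 (t - k) + 1 - 2 e` over `k ≤ t < Z` and
of `2 (k - t) - 1 + 2 e` over `Z ≤ t < k`. For `0 ≤ e ≤ 1/2`, all these terms are nonnegative. -/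
lemma lintegral_sq_le_of_tail (hZ : Measurable Z) {ψ : ℝ} (hψ : 0 ≤ ψ)
    (hU : ∀ t, μ {ω | t < Z ω} ≤ ENNReal.ofReal ((1 / 2) ^ t * ψ)) {N : ℕ}
    (hL : ∀ t, μ {ω | Z ω ≤ t} ≤ ENNReal.ofReal ((1 - (1 / 2) ^ t) ^ N)) (k : ℕ) {e : ℝ}
    (he0 : 0 ≤ e) (he : e ≤ 1 / 2) :
    ∫⁻ ω, ENNReal.ofReal ((Z ω - k - e) ^ 2) ∂μ ≤ ENNReal.ofReal (momentBound N ψ k e) := by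
  have hc : ∀ t : ℕ, 0 ≤ 2 * (t : ℝ) + 1 - 2 * e := fun t => by
    linarith [(Nat.cast_nonneg t : (0 : ℝ) ≤ t)]
  have hc' : ∀ t ∈ Finset.range k, 0 ≤ 2 * ((k : ℝ) - t) - 1 + 2 * e := fun t ht => by
    have : (t : ℝ) + 1 ≤ k := by exact_mod_cast Finset.mem_range.1 ht
    linarith
  have hb : ∀ t : ℕ, (0 : ℝ) ≤ (1 - (1 / 2) ^ t) ^ N := fun t =>
    pow_nonneg (sub_nonneg.2 (pow_le_one₀ (by norm_num) (by norm_num))) N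
  have hm : ∀ t, MeasurableSet {ω | Z ω ≤ t} := fun t => hZ measurableSet_Iic
  have h := lintegral_tsum_tail_le hZ hψ hU hc (hasSum_odd_mul_geometric e) k
  set T : Ω → ℝ≥0∞ := fun ω => ∑' t : ℕ, ENNReal.ofReal (2 * (t : ℝ) + 1 - 2 * e) *
    {ω | k + t < Z ω}.indicator 1 ω with hT
  calc ∫⁻ ω, ENNReal.ofReal ((Z ω - k - e) ^ 2) ∂μ
      ≤ ∫⁻ ω, (ENNReal.ofReal (e ^ 2) + ∑ t ∈ Finset.range k,
        ENNReal.ofReal (2 * ((k : ℝ) - t) - 1 + 2 * e) * {ω | Z ω ≤ t}.indicator 1 ω) + T ω ∂μ := by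
        refine lintegral_mono fun ω => ?_
        rcases le_total k (Z ω) with hk | hk
        · obtain ⟨d, hd⟩ := Nat.exists_eq_add_of_le hk
          have h1 : ((Z ω : ℝ) - k - e) ^ 2 = e ^ 2 + ∑ t ∈ Finset.range d,
              (2 * (t : ℝ) + 1 - 2 * e) := by
            rw [sum_range_odd, hd]; push_cast; ring
          rw [h1, ENNReal.ofReal_add (sq_nonneg e) (Finset.sum_nonneg fun t _ => hc t),
            ENNReal.ofReal_sum_of_nonneg fun t _ => hc t]
          refine add_le_add le_self_add ?_
          refine le_trans (Finset.sum_le_sum fun t ht => ?_)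
            (ENNReal.sum_le_tsum (Finset.range d))
          have : k + t < Z ω := by have := Finset.mem_range.1 ht; omega
          simp [this]
        · have h1 : ((Z ω : ℝ) - k - e) ^ 2 = e ^ 2 + ∑ t ∈ Finset.Ico (Z ω) k,
              (2 * ((k : ℝ) - t) - 1 + 2 * e) := by
            rw [sum_Ico_odd hk]; ring
          have hsub : Finset.Ico (Z ω) k ⊆ Finset.range k := fun t ht =>
            Finset.mem_range.2 (Finset.mem_Ico.1 ht).2
          refine le_trans ?_ le_self_add
          rw [h1, ENNReal.ofReal_add (sq_nonneg e) (Finset.sum_nonneg fun t ht => hc' t (hsub ht)),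
            ENNReal.ofReal_sum_of_nonneg fun t ht => hc' t (hsub ht)]
          refine add_le_add le_rfl (le_trans (Finset.sum_le_sum fun t ht => ?_)
            (Finset.sum_le_sum_of_subset hsub))
          simp [(Finset.mem_Ico.1 ht).1]
    _ ≤ (ENNReal.ofReal (e ^ 2) + ∑ t ∈ Finset.range k,
        ENNReal.ofReal ((2 * ((k : ℝ) - t) - 1 + 2 * e) * (1 - (1 / 2) ^ t) ^ N)) +
          ENNReal.ofReal ((6 - 4 * e) * ((1 / 2) ^ k * ψ)) := by
        rw [lintegral_add_left, lintegral_add_left measurable_const, lintegral_const, measure_univ,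
          mul_one, lintegral_finsetSum]
        · refine add_le_add (add_le_add le_rfl (Finset.sum_le_sum fun t ht => ?_)) h
          rw [lintegral_const_mul _ (measurable_one.indicator (hm t)),
            lintegral_indicator_one (hm t), ENNReal.ofReal_mul (hc' t ht)]
          gcongr
          exact hL t
        · exact fun t _ => (measurable_one.indicator (hm t)).const_mul _
        · refine Measurable.const_add (Finset.measurable_fun_sum _ fun t _ => ?_) _
          exact (measurable_one.indicator (hm t)).const_mul _
    _ = _ := by
        rw [momentBound, ENNReal.ofReal_add, ENNReal.ofReal_add (sq_nonneg e),
          ENNReal.ofReal_sum_of_nonneg]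
        · exact fun t ht => mul_nonneg (hc' t ht) (hb t)
        · exact Finset.sum_nonneg fun t ht => mul_nonneg (hc' t ht) (hb t)
        · exact add_nonneg (sq_nonneg e)
            (Finset.sum_nonneg fun t ht => mul_nonneg (hc' t ht) (hb t))
        · have : 0 ≤ 6 - 4 * e := by linarith
          positivity

lemma memLp_of_tail (hZ : Measurable Z) {ψ : ℝ} (hψ : 0 ≤ ψ)
    (hU : ∀ t, μ {ω | t < Z ω} ≤ ENNReal.ofReal ((1 / 2) ^ t * ψ)) :
    MemLp (fun ω => (Z ω : ℝ)) 2 μ := by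
  have hm : Measurable fun ω => (Z ω : ℝ) := (measurable_of_countable _).comp hZ
  rw [memLp_two_iff_integrable_sq hm.aestronglyMeasurable]
  refine ⟨(hm.pow_const 2).aestronglyMeasurable, ?_⟩
  rw [hasFiniteIntegral_iff_ofReal (.of_forall fun ω => sq_nonneg _)]
  have h := lintegral_sq_le_of_tail hZ hψ hU (N := 0) (fun t => by simpa using prob_le_one) 0
    (le_refl (0 : ℝ)) (by norm_num)
  simp only [Nat.cast_zero, sub_zero] at h
  exact h.trans_lt ENNReal.ofReal_lt_top

lemma integral_le_of_tail (hZ : Measurable Z) {ψ : ℝ} (hψ : 0 ≤ ψ)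
    (hU : ∀ t, μ {ω | t < Z ω} ≤ ENNReal.ofReal ((1 / 2) ^ t * ψ)) (k : ℕ) :
    ∫ ω, (Z ω : ℝ) ∂μ ≤ k + 2 * ((1 / 2) ^ k * ψ) := by
  have hm : Measurable fun ω => (Z ω : ℝ) := (measurable_of_countable _).comp hZ
  rw [integral_eq_lintegral_of_nonneg_ae (.of_forall fun ω => Nat.cast_nonneg _)
    hm.aestronglyMeasurable]
  exact ENNReal.toReal_le_of_le_ofReal (by positivity) (lintegral_le_of_tail hZ hψ hU k)

lemma variance_le_of_tail (hZ : Measurable Z) {ψ : ℝ} (hψ : 0 ≤ ψ)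
    (hU : ∀ t, μ {ω | t < Z ω} ≤ ENNReal.ofReal ((1 / 2) ^ t * ψ)) {N : ℕ}
    (hL : ∀ t, μ {ω | Z ω ≤ t} ≤ ENNReal.ofReal ((1 - (1 / 2) ^ t) ^ N)) (k : ℕ) {e : ℝ}
    (he0 : 0 ≤ e) (he : e ≤ 1 / 2) :
    Var[fun ω => (Z ω : ℝ); μ] ≤ momentBound N ψ k e := by
  have hm : Measurable fun ω => (Z ω : ℝ) := (measurable_of_countable _).comp hZ
  rw [← variance_sub_const hm.aestronglyMeasurable (k + e)]
  refine (variance_le_expectation_sq (hm.sub_const _).aestronglyMeasurable).trans ?_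
  simp only [Pi.pow_apply]
  rw [integral_eq_lintegral_of_nonneg_ae (.of_forall fun ω => sq_nonneg _)
    ((hm.sub_const _).pow_const 2).aestronglyMeasurable]
  refine ENNReal.toReal_le_of_le_ofReal (momentBound_nonneg hψ k he0 he) (le_of_eq_of_le ?_
    (lintegral_sq_le_of_tail hZ hψ hU hL k he0 he))
  refine lintegral_congr fun ω => ?_
  rw [sub_sub]

end

/-! ### The bound of the second moment -/

section

/-- The rational number `momentBound N ψ k (f / 2)` for the value `ψ` of `initBound (N - 1)`. -/
def momentBoundRat (N k f : ℕ) : ℚ :=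
  (f / 2) ^ 2 +
    ∑ t ∈ Finset.range k, (2 * ((k : ℚ) - t) - 1 + 2 * (f / 2)) * (1 - (1 / 2) ^ t) ^ N +
    (6 - 4 * (f / 2)) * ((1 / 2) ^ k * (17 / 5 * N + 16 / 5))

/-- The exponent `k` is the one with `73/400 ≤ N / 2 ^ k < 73/200`. -/
lemma momentBoundRat_lt : ∀ N < 94, 4 ≤ N →
    ∃ f < 2, momentBoundRat N (Nat.log2 (400 * N / 73)) f < 15 / 2 := by
  decide +kernel

lemma coe_momentBoundRat (N k f : ℕ) :
    (momentBoundRat N k f : ℝ) = momentBound N (17 / 5 * N + 16 / 5) k (f / 2) := by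
  simp [momentBoundRat, momentBound]

lemma exp_neg_le {x α : ℝ} (hx : 0 ≤ x) (hα : 0 < α)
    (h : 1 / α ≤ ∑ i ∈ Finset.range 8, x ^ i / i.factorial) : Real.exp (-x) ≤ α := by
  rw [Real.exp_neg, inv_le_comm₀ (Real.exp_pos x) hα, ← one_div]
  exact h.trans (Real.sum_le_exp_of_nonneg hx 8)

/-- Convexity of the powers of `exp (-2 * B)` in `B`. -/
lemma exp_pow_le_chord {a b s α β : ℝ} (hs : 0 ≤ s) (hs' : s ≤ 1) (hα : Real.exp (-(2 * a)) ≤ α)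
    (hβ : Real.exp (-(2 * b)) ≤ β) (m : ℕ) :
    Real.exp (-(2 * ((1 - s) * a + s * b))) ^ m ≤ (1 - s) * α ^ m + s * β ^ m := by
  have h := convexOn_exp.2 (Set.mem_univ (m * -(2 * a))) (Set.mem_univ (m * -(2 * b)))
    (sub_nonneg.2 hs') hs (by ring)
  simp only [smul_eq_mul] at h
  have h1 : Real.exp (-(2 * ((1 - s) * a + s * b))) ^ m =
      Real.exp ((1 - s) * (m * -(2 * a)) + s * (m * -(2 * b))) := by
    rw [← Real.exp_nat_mul]; congr 1; ring
  rw [h1]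
  refine h.trans ?_
  rw [Real.exp_nat_mul, Real.exp_nat_mul]
  have h2 := sub_nonneg.2 hs'
  gcongr

lemma one_sub_pow_le_exp (N i : ℕ) : (1 - (1 / 2 : ℝ) ^ i) ^ N ≤ Real.exp (-(N * (1 / 2) ^ i)) := by
  have h0 : (0 : ℝ) ≤ 1 - (1 / 2) ^ i :=
    sub_nonneg.2 (pow_le_one₀ (by norm_num) (by norm_num))
  have h : (1 : ℝ) - (1 / 2) ^ i ≤ Real.exp (-(1 / 2) ^ i) := by
    have := Real.add_one_le_exp (-(1 / 2 : ℝ) ^ i)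
    linarith
  calc (1 - (1 / 2 : ℝ) ^ i) ^ N ≤ Real.exp (-(1 / 2) ^ i) ^ N := pow_le_pow_left₀ h0 h N
    _ = _ := by rw [← Real.exp_nat_mul]; congr 1; ring

/-- With `t = k - 1 - j`, the power `(1 - 2⁻ᵗ) ^ N` is at most `exp (-2 ^ (j + 1) * N / 2 ^ k)`. -/
lemma sum_lower_le {N k : ℕ} {e : ℝ} (he0 : 0 ≤ e) :
    ∑ t ∈ Finset.range k, (2 * ((k : ℝ) - t) - 1 + 2 * e) * (1 - (1 / 2) ^ t) ^ N ≤
      ∑ j ∈ Finset.range k, (2 * (j : ℝ) + 1 + 2 * e) *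
        Real.exp (-(2 * (N * (1 / 2) ^ k))) ^ 2 ^ j := by
  rw [← Finset.sum_range_reflect]
  refine Finset.sum_le_sum fun j hj => ?_
  have hj' : j + 1 ≤ k := Finset.mem_range.1 hj
  obtain ⟨i, rfl⟩ := Nat.exists_eq_add_of_le hj'
  have hsub : j + 1 + i - 1 - j = i := by omega
  rw [hsub]
  have h1 : 2 * (((j + 1 + i : ℕ) : ℝ) - i) - 1 + 2 * e = 2 * (j : ℝ) + 1 + 2 * e := by
    push_cast; ring
  rw [h1]
  have h2 : Real.exp (-(2 * (N * (1 / 2) ^ (j + 1 + i)))) ^ 2 ^ j =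
      Real.exp (-(N * (1 / 2 : ℝ) ^ i)) := by
    rw [← Real.exp_nat_mul]
    congr 1
    have : (2 : ℝ) ^ j * (1 / 2) ^ j = 1 := by rw [← mul_pow]; norm_num
    rw [pow_add, pow_add]
    push_cast
    linear_combination (-(N : ℝ) * (1 / 2) ^ i) * this
  rw [h2]
  exact mul_le_mul_of_nonneg_left (one_sub_pow_le_exp N i) (by positivity)

/-- The terms of degree at least `32` are negligible. -/
lemma sum_pow_two_pow_le {Y e : ℝ} (hY : 0 ≤ Y) (hY' : Y ≤ 7 / 10) (he0 : 0 ≤ e) (he : e ≤ 1 / 2)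
    (l : ℕ) :
    ∑ j ∈ Finset.range (5 + l), (2 * (j : ℝ) + 1 + 2 * e) * Y ^ 2 ^ j ≤
      (1 + 2 * e) * Y ^ 1 + (3 + 2 * e) * Y ^ 2 + (5 + 2 * e) * Y ^ 4 + (7 + 2 * e) * Y ^ 8 +
        (9 + 2 * e) * Y ^ 16 + 3 / 10000 := by
  have hz : Y ^ 32 ≤ 12 / 1000000 := (pow_le_pow_left₀ hY hY' 32).trans (by norm_num)
  have hz0 : 0 ≤ Y ^ 32 := by positivity
  have hj : ∀ j ∈ Finset.range l, (2 * ((5 + j : ℕ) : ℝ) + 1 + 2 * e) * Y ^ 2 ^ (5 + j) ≤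
      (1 / 2) ^ j * (12 * (12 / 1000000)) := by
    intro j _
    have h1 : (j : ℝ) + 1 ≤ 2 ^ j := by exact_mod_cast Nat.lt_two_pow_self (n := j)
    have h2 : Y ^ 2 ^ (5 + j) ≤ (12 / 1000000) * (1 / 4) ^ j := by
      calc Y ^ 2 ^ (5 + j) = (Y ^ 32) ^ 2 ^ j := by rw [← pow_mul, pow_add]; norm_num
        _ ≤ (12 / 1000000) ^ 2 ^ j := pow_le_pow_left₀ hz0 hz _
        _ ≤ (12 / 1000000) ^ (1 + j) :=
            pow_le_pow_of_le_one (by norm_num) (by norm_num)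
              (by rw [add_comm]; exact Nat.lt_two_pow_self (n := j))
        _ ≤ (12 / 1000000) * (1 / 4) ^ j := by
            rw [pow_add, pow_one]
            exact mul_le_mul_of_nonneg_left (pow_le_pow_left₀ (by norm_num) (by norm_num) j)
              (by norm_num)
    have h3 : (2 * ((5 + j : ℕ) : ℝ) + 1 + 2 * e) ≤ 12 * 2 ^ j := by
      push_cast
      linarith [(Nat.cast_nonneg j : (0 : ℝ) ≤ j)]
    calc (2 * ((5 + j : ℕ) : ℝ) + 1 + 2 * e) * Y ^ 2 ^ (5 + j)
        ≤ 12 * 2 ^ j * ((12 / 1000000) * (1 / 4) ^ j) := by gcongr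
      _ = (2 * (1 / 4)) ^ j * (12 * (12 / 1000000)) := by rw [mul_pow]; ring
      _ = (1 / 2) ^ j * (12 * (12 / 1000000)) := by norm_num
  have htail := Finset.sum_le_sum hj
  rw [← Finset.sum_mul] at htail
  have hg := sum_geometric_two_le l
  rw [Finset.sum_range_add]
  have h5 : ∑ j ∈ Finset.range 5, (2 * (j : ℝ) + 1 + 2 * e) * Y ^ 2 ^ j =
      (1 + 2 * e) * Y ^ 1 + (3 + 2 * e) * Y ^ 2 + (5 + 2 * e) * Y ^ 4 + (7 + 2 * e) * Y ^ 8 +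
        (9 + 2 * e) * Y ^ 16 := by
    simp only [Finset.sum_range_succ, Finset.sum_range_zero]
    norm_num
  rw [h5]
  have : (∑ j ∈ Finset.range l, (1 / 2 : ℝ) ^ j) * (12 * (12 / 1000000)) ≤
      2 * (12 * (12 / 1000000)) := by gcongr
  linarith

/-- The limit of `momentBound` for large `N`, as a function of `α = exp (-2 * B)` and
`B = N / 2 ^ k`, without the terms of degree larger than `16` in `α`. -/
def limitBound (e α B : ℝ) : ℝ :=
  e ^ 2 + ((1 + 2 * e) * α ^ 1 + (3 + 2 * e) * α ^ 2 + (5 + 2 * e) * α ^ 4 + (7 + 2 * e) * α ^ 8 +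
    (9 + 2 * e) * α ^ 16) + (6 - 4 * e) * (17 / 5) * B

/-- On an interval of values of `B = N / 2 ^ k`, the convex function `limitBound e (exp (-2 * B)) B`
is bounded by its values at the ends. -/
lemma momentBound_le_chord {N k : ℕ} {e a b α β C : ℝ} (hk : 9 ≤ k) (he0 : 0 ≤ e)
    (he : e ≤ 1 / 2) (hab : a < b) (hα : Real.exp (-(2 * a)) ≤ α)
    (hα' : α ≤ 7 / 10) (hβ : Real.exp (-(2 * b)) ≤ β) (hN : a ≤ N * (1 / 2) ^ k)
    (hN' : N * (1 / 2) ^ k ≤ b) (h1 : limitBound e α a ≤ C) (h2 : limitBound e β b ≤ C) :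
    momentBound N (17 / 5 * N + 16 / 5) k e ≤ C + 3 / 10000 + (6 - 4 * e) / 160 := by
  set B : ℝ := N * (1 / 2) ^ k with hB
  set s := (B - a) / (b - a) with hs
  have hba : 0 < b - a := sub_pos.2 hab
  have hs0 : 0 ≤ s := div_nonneg (sub_nonneg.2 hN) hba.le
  have hs1 : s ≤ 1 := (div_le_one hba).2 (by linarith)
  have hBs : B = (1 - s) * a + s * b := by
    have : s * (b - a) = B - a := div_mul_cancel₀ _ hba.ne'
    linarith
  have hY : Real.exp (-(2 * B)) ≤ 7 / 10 :=
    (Real.exp_le_exp.2 (by linarith)).trans (hα.trans hα')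
  obtain ⟨l, rfl⟩ := Nat.exists_eq_add_of_le (show 5 ≤ k by omega)
  have h3 := (sum_lower_le (N := N) (k := 5 + l) he0).trans
    (sum_pow_two_pow_le (Real.exp_pos _).le hY he0 he l)
  have hp : ((1 : ℝ) / 2) ^ (5 + l) ≤ 1 / 512 := by
    calc ((1 : ℝ) / 2) ^ (5 + l) ≤ (1 / 2) ^ 9 :=
          pow_le_pow_of_le_one (by norm_num) (by norm_num) hk
      _ = _ := by norm_num
  have hψ : (1 / 2 : ℝ) ^ (5 + l) * (17 / 5 * N + 16 / 5) ≤ 17 / 5 * B + 1 / 160 := by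
    rw [hB]; linarith
  have hψ' := mul_le_mul_of_nonneg_left hψ (show 0 ≤ 6 - 4 * e by linarith)
  have hch := fun m => exp_pow_le_chord hs0 hs1 hα hβ m
  rw [← hBs] at hch
  have c1 := mul_le_mul_of_nonneg_left (hch 1) (show 0 ≤ 1 + 2 * e by linarith)
  have c2 := mul_le_mul_of_nonneg_left (hch 2) (show 0 ≤ 3 + 2 * e by linarith)
  have c3 := mul_le_mul_of_nonneg_left (hch 4) (show 0 ≤ 5 + 2 * e by linarith)
  have c4 := mul_le_mul_of_nonneg_left (hch 8) (show 0 ≤ 7 + 2 * e by linarith)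
  have c5 := mul_le_mul_of_nonneg_left (hch 16) (show 0 ≤ 9 + 2 * e by linarith)
  have hC : (1 - s) * limitBound e α a + s * limitBound e β b ≤ C := by
    have := mul_le_mul_of_nonneg_left h1 (sub_nonneg.2 hs1)
    have := mul_le_mul_of_nonneg_left h2 hs0
    linarith
  have hlin : (6 - 4 * e) * (17 / 5) * B =
      (1 - s) * ((6 - 4 * e) * (17 / 5) * a) + s * ((6 - 4 * e) * (17 / 5) * b) := by
    rw [hBs]; ring
  unfold momentBound
  unfold limitBound at hC
  linarith

lemma exists_momentBound_lt_of_large {N k : ℕ} (hk : 9 ≤ k) (h : 73 / 400 ≤ N * (1 / 2 : ℝ) ^ k)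
    (h' : N * (1 / 2 : ℝ) ^ k ≤ 73 / 200) : ∃ e : ℝ, 0 ≤ e ∧ e ≤ 1 / 2 ∧
      momentBound N (17 / 5 * N + 16 / 5) k e < 15 / 2 := by
  have e1 : Real.exp (-(2 * (73 / 400))) ≤ 6943 / 10000 :=
    exp_neg_le (by norm_num) (by norm_num) (by norm_num [Finset.sum_range_succ, Nat.factorial])
  have e2 : Real.exp (-(2 * (11 / 50))) ≤ 6441 / 10000 :=
    exp_neg_le (by norm_num) (by norm_num) (by norm_num [Finset.sum_range_succ, Nat.factorial])
  have e3 : Real.exp (-(2 * (73 / 200))) ≤ 4820 / 10000 :=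
    exp_neg_le (by norm_num) (by norm_num) (by norm_num [Finset.sum_range_succ, Nat.factorial])
  rcases le_total (N * (1 / 2 : ℝ) ^ k) (11 / 50) with hB | hB
  · refine ⟨0, le_rfl, by norm_num, (momentBound_le_chord (C := 7453 / 1000) hk le_rfl (by norm_num)
      (by norm_num) e1 (by norm_num) e2 h hB ?_ ?_).trans_lt ?_⟩ <;>
    norm_num [limitBound]
  · refine ⟨1 / 2, by norm_num, le_rfl, (momentBound_le_chord (C := 7469 / 1000) hk (by norm_num)
      le_rfl (by norm_num) e2 (by norm_num) e3 hB h' ?_ ?_).trans_lt ?_⟩ <;>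
    norm_num [limitBound]

/-- The two tail bounds are sharp enough for the bound of the variance, whatever the number `n` of
conflicting neighbours is. -/
lemma exists_momentBound_lt (n : ℕ) : ∃ (k : ℕ) (e : ℝ), 0 ≤ e ∧ e ≤ 1 / 2 ∧
    momentBound (n + 1) (initBound n) k e < 15 / 2 := by
  rcases Nat.eq_zero_or_pos n with rfl | hn
  · exact ⟨2, 1 / 2, by norm_num, le_rfl, by
      norm_num [momentBound, initBound, Finset.sum_range_succ]⟩
  have hψ : initBound n = 17 / 5 * ((n + 1 : ℕ) : ℝ) + 16 / 5 := by
    rw [initBound, if_neg hn.ne']; push_cast; ring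
  rw [hψ]
  generalize hN : n + 1 = N
  rcases lt_or_ge N 94 with h94 | h94
  · rcases lt_or_ge N 4 with h4 | h4
    · interval_cases N
      · omega
      · omega
      · exact ⟨3, 1 / 2, by norm_num, le_rfl, by
          norm_num [momentBound, Finset.sum_range_succ]⟩
      · exact ⟨4, 1 / 2, by norm_num, le_rfl, by
          norm_num [momentBound, Finset.sum_range_succ]⟩
    · obtain ⟨f, hf, h⟩ := momentBoundRat_lt N h94 h4
      refine ⟨Nat.log2 (400 * N / 73), f / 2, by positivity, ?_, ?_⟩
      · have : (f : ℝ) ≤ 1 := by exact_mod_cast Nat.lt_succ_iff.1 hf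
        linarith
      · rw [← coe_momentBoundRat]
        exact ((Rat.cast_lt (K := ℝ)).2 h).trans_eq (by norm_num)
  · -- choose `k` such that `73/400 ≤ N / 2 ^ k < 73/200`
    have hN' : (94 : ℝ) ≤ N := by exact_mod_cast h94
    obtain ⟨k, hk, hk'⟩ := exists_nat_pow_near (x := 400 / 73 * (N : ℝ)) (y := 2) (by linarith)
      (by norm_num)
    have h2 : (2 : ℝ) ^ k * (1 / 2) ^ k = 1 := by rw [← mul_pow]; norm_num
    have hp : (0 : ℝ) < (1 / 2) ^ k := by positivity
    have hk9 : 9 ≤ k := by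
      by_contra hlt
      have : (2 : ℝ) ^ (k + 1) ≤ 2 ^ 9 := pow_le_pow_right₀ (by norm_num) (by omega)
      norm_num at this
      linarith
    have h3 := mul_le_mul_of_nonneg_right hk hp.le
    have h4 := mul_le_mul_of_nonneg_right hk'.le hp.le
    rw [pow_succ] at h4
    exact ⟨k, exists_momentBound_lt_of_large hk9 (by nlinarith) (by nlinarith)⟩

end

/-! ### The bounds of the moments -/

section

/-- The bound of the mean in `integral_le_of_tail` is at most `log₂ ψ + 2` if `2 ^ k` is the
smallest power of two larger than `ψ`. -/
lemma exists_meanBound_le {ψ : ℝ} (hψ : 1 ≤ ψ) :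
    ∃ k : ℕ, k + 2 * ((1 / 2) ^ k * ψ) ≤ Real.log ψ / Real.log 2 + 2 := by
  obtain ⟨k, hk, hk'⟩ := exists_nat_pow_near hψ (by norm_num : (1 : ℝ) < 2)
  have hp : (0 : ℝ) < 2 ^ k := by positivity
  have h2 : (2 : ℝ) ^ k * (1 / 2) ^ k = 1 := by rw [← mul_pow]; norm_num
  set x : ℝ := (1 / 2) ^ k * ψ with hx
  have hψx : ψ = 2 ^ k * x := by rw [hx, ← mul_assoc, h2, one_mul]
  rw [hψx] at hk hk'
  have hx1 : 1 ≤ x := by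
    rw [le_mul_iff_one_le_right hp] at hk; exact hk
  have hx2 : x < 2 := by
    rw [pow_succ, mul_lt_mul_iff_right₀ hp] at hk'; exact hk'
  have hlog2 : 0 < Real.log 2 := Real.log_pos (by norm_num)
  -- Bernoulli's inequality `2 ^ (x - 1) ≤ x`
  have hlog : (x - 1) * Real.log 2 ≤ Real.log x := by
    have hb := rpow_one_add_le_one_add_mul_self (s := 1) (p := x - 1) (by norm_num)
      (by linarith) (by linarith)
    have h3 := Real.log_le_log (by positivity) hb
    rw [Real.log_rpow (by norm_num)] at h3
    norm_num at h3
    exact h3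
  refine ⟨k + 1, ?_⟩
  have h4 : (1 / 2 : ℝ) ^ (k + 1) * ψ = x / 2 := by rw [hx, pow_succ]; ring
  have h5 : Real.log ψ = k * Real.log 2 + Real.log x := by
    rw [hψx, Real.log_mul hp.ne' (by linarith), Real.log_pow]
  rw [h4, h5, ← sub_le_iff_le_add, le_div_iff₀ hlog2]
  push_cast
  linarith

lemma log_initBound_le (n : ℕ) :
    Real.log (initBound n) / Real.log 2 ≤ (harmonic n : ℝ) / Real.log 2 + 5 / 2 := by
  have hlog2 : 0 < Real.log 2 := Real.log_pos (by norm_num)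
  have hn : (0 : ℝ) ≤ n := Nat.cast_nonneg n
  have h1 : initBound n ≤ 565 / 100 * (n + 1) := by
    unfold initBound
    split_ifs with h
    · simp [h]; norm_num
    · have : (1 : ℝ) ≤ n := by exact_mod_cast Nat.one_le_iff_ne_zero.2 h
      linarith
  -- `5.65` is slightly smaller than `2 ^ (5 / 2)`
  have h2 : Real.log (565 / 100) ≤ 5 / 2 * Real.log 2 := by
    have : 2 * Real.log (565 / 100) ≤ 5 * Real.log 2 := by
      have h3 := Real.log_le_log (by norm_num) (by norm_num : ((565 / 100 : ℝ) ^ 2) ≤ 2 ^ 5)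
      rw [Real.log_pow, Real.log_pow] at h3
      exact_mod_cast h3
    linarith
  have h3 := log_add_one_le_harmonic n
  have h4 := Real.log_le_log (zero_lt_one.trans_le (one_le_initBound n)) h1
  rw [Real.log_mul (by norm_num) (by positivity)] at h4
  rw [div_add' _ _ _ hlog2.ne']
  gcongr
  push_cast at h3 ⊢
  linarith

lemma harmonic_mono {m n : ℕ} (h : m ≤ n) : harmonic m ≤ harmonic n :=
  Finset.sum_le_sum_of_subset_of_nonneg (Finset.range_mono h) fun _ _ _ => by positivity

/-- The moments of a random time `τ` with two-sided bounds for its distribution. The second one,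
with `t = 0`, implies that `τ` is almost surely larger than `1`. -/
lemma moments_of_tail {Ω : Type*} [MeasurableSpace Ω] {μ : Measure Ω} [IsProbabilityMeasure μ]
    {τ : Ω → ℕ} (hτ : Measurable τ) (n : ℕ)
    (hU : ∀ t, μ {ω | t + 1 < τ ω} ≤ ENNReal.ofReal ((1 / 2) ^ t * initBound n))
    (hL : ∀ t, μ {ω | τ ω ≤ t + 1} ≤ ENNReal.ofReal ((1 - (1 / 2) ^ t) ^ (n + 1))) :
    MemLp (fun ω => (τ ω : ℝ)) 2 μ ∧
      ∫ ω, (τ ω : ℝ) ∂μ ≤ (harmonic n : ℝ) / Real.log 2 + 11 / 2 ∧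
      Var[fun ω => (τ ω : ℝ); μ] < 15 / 2 := by
  have hψ : 0 ≤ initBound n := zero_le_one.trans (one_le_initBound n)
  have hZ : Measurable fun ω => τ ω - 1 := (measurable_of_countable fun n : ℕ => n - 1).comp hτ
  have hU' : ∀ t, μ {ω | t < τ ω - 1} ≤ ENNReal.ofReal ((1 / 2) ^ t * initBound n) := fun t => by
    simpa only [Nat.lt_sub_iff_add_lt] using hU t
  have hL' : ∀ t, μ {ω | τ ω - 1 ≤ t} ≤ ENNReal.ofReal ((1 - (1 / 2) ^ t) ^ (n + 1)) := fun t => by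
    simpa only [Nat.sub_le_iff_le_add] using hL t
  have h1 : ∀ᵐ ω ∂μ, (τ ω : ℝ) = ((τ ω - 1 : ℕ) : ℝ) + 1 := by
    have h0 : μ {ω | τ ω ≤ 0 + 1} = 0 := le_antisymm ((hL 0).trans (by simp)) zero_le
    filter_upwards [measure_eq_zero_iff_ae_notMem.1 h0] with ω hω
    have hω' : ¬ τ ω ≤ 0 + 1 := hω
    rw [Nat.cast_sub (by omega)]
    simp
  have hLp := memLp_of_tail hZ hψ hU'
  have hLp1 : MemLp (fun ω => ((τ ω - 1 : ℕ) : ℝ) + 1) 2 μ := hLp.add (memLp_const 1)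
  refine ⟨(memLp_congr_ae h1).2 hLp1, ?_, ?_⟩
  · rw [integral_congr_ae h1, integral_add (hLp.integrable one_le_two) (integrable_const _)]
    simp only [integral_const, probReal_univ, smul_eq_mul, mul_one]
    obtain ⟨k, hk⟩ := exists_meanBound_le (one_le_initBound n)
    have h2 := integral_le_of_tail hZ hψ hU' k
    have h3 := log_initBound_le n
    linarith
  · rw [variance_congr h1, variance_add_const hLp.aestronglyMeasurable]
    obtain ⟨k, e, he0, he, hlt⟩ := exists_momentBound_lt n
    exact (variance_le_of_tail hZ hψ hU' hL' k he0 he).trans_lt hlt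

end

end Coloring

end

theorem mainTheorem4 {V : Type*} [Fintype V] (G : SimpleGraph V) [DecidableRel G.Adj]
    (v : V) (ρ σ : Config V) (hρ : Coloring.Legitimate G ρ)
    (hσ : Coloring.MemoryCorruption ρ σ v) :
    (∀ᵐ ω ∂(Coloring.execution G σ), ∃ n, Coloring.Legitimate G (ω n)) ∧
    MemLp (fun ω => (Coloring.recoveryTime G ω : ℝ)) 2 (Coloring.execution G σ) ∧
    ∫ ω, (Coloring.recoveryTime G ω : ℝ) ∂(Coloring.execution G σ) ≤
      (harmonic (Coloring.indepDegree G v) : ℝ) / Real.log 2 + 11 / 2 ∧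
    Var[fun ω => (Coloring.recoveryTime G ω : ℝ); Coloring.execution G σ] < 15 / 2 := by
  open Coloring in
  classical
  have hmτ : Measurable fun ω => (recoveryTime G ω : ℝ) :=
    (measurable_of_countable _).comp (measurable_recoveryTime G)
  have hlog2 : 0 < Real.log 2 := Real.log_pos (by norm_num)
  cases hv : newFinal G σ v with
  | true =>
    -- the configuration is legitimate after the deterministic part of the first round
    have h1 : execution G σ {ω | ¬ Legitimate G (ω 1)} = 0 := by
      refine (execution_mem G σ {Y | ¬ Legitimate G Y} 1).trans ?_
      rw [Function.iterate_one, stepExp, lintegral_indicator_one (Set.to_countable _).measurableSet]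
      exact ae_iff.1 (hσ.ae_legitimate_step hρ hv)
    have h2 : ∀ᵐ ω ∂(execution G σ), Legitimate G (ω 1) := ae_iff.2 h1
    have h3 : ∀ᵐ ω ∂(execution G σ), (recoveryTime G ω : ℝ) ∈ Set.Icc (0 : ℝ) 1 :=
      h2.mono fun ω hω => ⟨Nat.cast_nonneg _, by exact_mod_cast (Nat.sInf_le hω : _ ≤ 1)⟩
    refine ⟨h2.mono fun ω hω => ⟨1, hω⟩, memLp_of_bounded h3 hmτ.aestronglyMeasurable 2, ?_, ?_⟩
    · have h4 : ∫ ω, (recoveryTime G ω : ℝ) ∂(execution G σ) ≤ ∫ _, (1 : ℝ) ∂(execution G σ) :=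
        integral_mono_of_nonneg (.of_forall fun ω => Nat.cast_nonneg _) (integrable_const _)
          (h3.mono fun ω hω => hω.2)
      have h5 : (0 : ℝ) ≤ (harmonic (indepDegree G v) : ℝ) / Real.log 2 := by
        have : (0 : ℚ) ≤ harmonic (indepDegree G v) :=
          Finset.sum_nonneg fun _ _ => by positivity
        have : (0 : ℝ) ≤ (harmonic (indepDegree G v) : ℝ) := by exact_mod_cast this
        positivity
      simp only [integral_const, probReal_univ, smul_eq_mul, mul_one] at h4
      linarith
    · exact (variance_le_sq_of_bounded h3 hmτ.aemeasurable).trans_lt (by norm_num)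
  | false =>
    set W : Finset V :=
      {w | G.Adj v w ∧ (σ v).isFinal = true ∧ (σ w).color = (σ v).color} with hWdef
    have hW : ∀ w, w ∈ W ↔ G.Adj v w ∧ (σ v).isFinal = true ∧ (σ w).color = (σ v).color := by
      simp [hWdef]
    have hadj : ∀ w ∈ W, G.Adj v w := fun w hw => ((hW w).1 hw).1
    have htail := hσ.stepExp_iterate_le hρ hv hW
    have hex := ae_exists_legitimate htail
    have hcard : W.card ≤ indepDegree G v := by
      refine card_le_indepDegree G hadj fun w hw w' hw' hww' => hρ.2 w w' hww' ?_
      rw [← hσ.2 w (hadj w hw).ne', ← hσ.2 w' (hadj w' hw').ne', ((hW w).1 hw).2.2,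
        ((hW w').1 hw').2.2]
    have hpend : W.card + 1 ≤ (pending G σ).card := by
      have hvW : v ∉ W := fun h => (hadj v h).ne rfl
      rw [← Finset.card_insert_of_notMem hvW]
      refine Finset.card_le_card fun u hu => ?_
      simp only [pending, Finset.mem_filter, Finset.mem_univ, true_and]
      rcases Finset.mem_insert.1 hu with rfl | hu
      · exact hv
      · exact hσ.newFinal_eq_false hρ (hadj u hu) ((hW u).1 hu).2.1 ((hW u).1 hu).2.2
    obtain ⟨h1, h2, h3⟩ := moments_of_tail (measurable_recoveryTime G) W.card
      (fun t => (execution_lt_recoveryTime hex (t + 1)).trans_le (htail t))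
      (fun t => by
        refine (execution_recoveryTime_le hex (t + 1)).trans_le
          ((stepExp_iterate_legitimate_le G t σ).trans (ENNReal.ofReal_le_ofReal ?_))
        exact pow_le_pow_of_le_one (sub_nonneg.2 (pow_le_one₀ (by norm_num) (by norm_num)))
          (sub_le_self 1 (by positivity)) hpend)
    refine ⟨hex, h1, h2.trans ?_, h3⟩
    gcongr
    exact_mod_cast harmonic_mono hcard
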